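/- **Setting.** Let $\mathcal U$ be a separable metric space (for example $\mathbb R^d$) with metric $|u-u'|$ and its Borel $\sigma$-algebra, and let $\mathcal V=\mathcal U\times\mathcal U$. Let $G_n:\mathcal U\to(0,\infty)$ $(n\ge 0)$ be measurable potentials, $\eta_0$ a probability measure on $\mathcal V$, and $M_n$ $(n\ge1)$ Markov kernels on $\mathcal V$ with marginals $M_{n,1},M_{n,2}$: for $v=(u_1,u_2)$ and $j\in\{1,2\}$, the $j$-th marginal of $M_n(v,\cdot)$ is $M_{n,j}(u_j,\cdot)$, where $M_{n,j}$ is a Markov kernel on $\mathcal U$. For a measure $\mu$ on $\mathcal V$ let $\mu_j$ be its $j$-th marginal. Define $$\gamma_{n,j}(du_n)=\int\prod_{p=0}^{n-1}G_p(u_p)\,\eta_{0,j}(du_0)\prod_{p=1}^nM_{p,j}(u_{p-1},du_p),\qquad \eta_{n,j}=\frac{\gamma_{n,j}}{\gamma_{n,j}(1)} .$$ **Coupled particle filter.** For a probability measure $\mu$ on $\mathcal V$ put $G_{n,j,\mu}(v)=G_n(u_j)/\mu_j(G_n)$ and $\bar G_{n,\mu}=G_{n,1,\mu}\wedge G_{n,2,\mu}$,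 and for $n\ge1$, writing $\bar M_n((v,\tilde v),\cdot)=M_n((u_1,\tilde u_2),\cdot)$, $$\bar\Phi_n(\mu)=\mu(\bar G_{n-1,\mu})\,\frac{\mu(\bar G_{n-1,\mu}M_n)}{\mu(\bar G_{n-1,\mu})}+\bigl(1-\mu(\bar G_{n-1,\mu})\bigr)\,(\mu\otimes\mu)\Bigl(\Bigl[\tfrac{G_{n-1,1,\mu}-\bar G_{n-1,\mu}}{\mu(G_{n-1,1,\mu}-\bar G_{n-1,\mu})}\otimes\tfrac{G_{n-1,2,\mu}-\bar G_{n-1,\mu}}{\mu(G_{n-1,2,\mu}-\bar G_{n-1,\mu})}\Bigr]\bar M_n\Bigr),$$ the second term being $0$ when $\mu(\bar G_{n-1,\mu})=1$. For $N\ge1$ the coupled particle filter is the process of particles $(U^i_{p,1},U^i_{p,2})_{1\le i\le N}$, $p\ge0$, where the particles at time $0$ are i.i.d. from $\eta_0$ and, given the past up to time $p-1$, those at time $p$ are i.i.d. from $\bar\Phi_p(\bar\eta^N_{p-1})$, $\bar\eta^N_{p-1}$ being the empirical measure of the particles at time $p-1$. Write $\mathbb E_N$ for expectation under its law and $$\gamma^N_{n,j}(1)=\prod_{p=0}^{n-1}\frac1N\sum_{i=1}^NG_p(U^i_{p,j}).$$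 **Assumptions.** Let $c>1$, $C>0$ and $C_n>0$ $(n\ge 1)$. (A1) $c^{-1}<G_n(x)<c$ and $|G_n(x)-G_n(x')|\le C|x-x'|$ for all $n\ge0$ and $x,x'\in\mathcal U$. (A2) $|M_{n,j}(\varphi)(u)-M_{n,j}(\varphi)(u')|\le C_n\|\varphi\|\,|u-u'|$ for all $n\ge1$, $j\in\{1,2\}$, $u,u'\in\mathcal U$ and all bounded Lipschitz $\varphi:\mathcal U\to\mathbb R$, where $\|\cdot\|$ is the supremum norm. **The constants.** Let $\|\mu-\nu\|_{\rm tv}=\sup_A|\mu(A)-\nu(A)|$, let $|||M_{p,1}-M_{p,2}|||$ be the supremum of $|M_{p,1}(\varphi)(x)-M_{p,2}(\varphi)(x)|$ over $x\in\mathcal U$ and all Lipschitz $\varphi$ with $\|\varphi\|\le1$, and let $$B_N(n)=\Bigl(\sum_{p=0}^n\bigl\{\mathbb E_N\bigl[\{|U^1_{p,1}-U^1_{p,2}|\wedge1\}^2\bigr]^{1/2}+\|\eta_{p,1}-\eta_{p,2}\|_{\rm tv}\bigr\}+\sum_{p=1}^n|||M_{p,1}-M_{p,2}|||\Bigr)^2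 .$$ Given constants $K(n)>0$ $(n\ge0)$, let $\overline B_N(0)=K(0)B_N(0)$ and, for $n\ge1$, $$\overline B_N(n)=K(n)\Bigl[B_N(n-1)+\overline B_N(n-1)+\|\eta_{n-1,1}-\eta_{n-1,2}\|_{\rm tv}^2+\bigl(\gamma_{n-1,1}(1)-\gamma_{n-1,2}(1)\bigr)^2\Bigr].$$ **Proposition.** For all $c>1$, $C>0$ and $(C_n)_{n\ge1}$ in $(0,\infty)$ there are constants $K(n)\in(0,\infty)$, $n\ge0$, depending only on these, such that for every model as above that satisfies (A1) and (A2) with these constants, and all $n\ge1$ and $N\ge1$, the random variable below is integrable and $$\mathbb E_N\Bigl[\bigl([\gamma^N_{n,1}(1)-\gamma^N_{n,2}(1)]-[\gamma_{n,1}(1)-\gamma_{n,2}(1)]\bigr)^2\Bigr]\le\frac{\overline B_N(n)}{N}.$$ -/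

import Mathlib

open MeasureTheory ProbabilityTheory
open scoped ENNReal NNReal BoundedContinuousFunction

noncomputable section

namespace CoupledPF

universe u

/-- The coordinate `u_j` of `v = (u_1, u_2)`. The index `0 : Fin 2` is the fine level (written
`j = 1` in the usual notation), the index `1 : Fin 2` is the coarse level (`j = 2`). -/
def proj {U : Type u} (j : Fin 2) (v : U × U) : U := if j = 0 then v.1 else v.2

lemma measurable_proj {U : Type u} [MeasurableSpace U] (j : Fin 2) :
    Measurable (proj (U := U) j) := by
  unfold proj
  split_ifs
  · exact measurable_fst
  · exact measurable_snd

/-- The data of a coupled Feynman-Kac model on `V = U × U`: potentials `G_n : U → (0, ∞)`, an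
initial law `η_0` on `V`, Markov kernels `M_n` on `V` (used for `n ≥ 1` only; `M 0` plays no role)
and Markov kernels `M_{n,j}` on `U` such that the `j`-th marginal of `M_n(v, ·)` is
`M_{n,j}(u_j, ·)`. -/
structure Model (U : Type u) [MeasurableSpace U] where
  G : ℕ → U → ℝ
  measurable_G : ∀ n, Measurable (G n)
  G_pos : ∀ n u, 0 < G n u
  η₀ : Measure (U × U)
  isProbabilityMeasure_η₀ : IsProbabilityMeasure η₀
  M : ℕ → Kernel (U × U) (U × U)
  isMarkovKernel_M : ∀ n, IsMarkovKernel (M n)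
  Mj : Fin 2 → ℕ → Kernel U U
  isMarkovKernel_Mj : ∀ j n, IsMarkovKernel (Mj j n)
  marginal : ∀ n, 1 ≤ n → ∀ (j : Fin 2) (v : U × U),
    (M n v).map (proj j) = Mj j n (proj j v)

attribute [instance] Model.isProbabilityMeasure_η₀ Model.isMarkovKernel_M
  Model.isMarkovKernel_Mj

namespace Model

variable {U : Type u} [MeasurableSpace U]

/-! ### Marginal Feynman-Kac formulae -/

/-- The unnormalised marginal measure
`γ_{n,j}(du_n) = ∫ ∏_{p<n} G_p(u_p) η_{0,j}(du_0) ∏_{p=1}^n M_{p,j}(u_{p-1}, du_p)`,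
integrated one variable at a time. -/
def γ (F : Model U) (j : Fin 2) : ℕ → Measure U
  | 0 => F.η₀.map (proj j)
  | n + 1 => ((F.γ j n).withDensity fun u => ENNReal.ofReal (F.G n u)).bind (F.Mj j (n + 1))

/-- The normalising constant `γ_{n,j}(1)`. -/
def Z (F : Model U) (j : Fin 2) (n : ℕ) : ℝ := (F.γ j n).real Set.univ

/-- The normalised marginal measure `η_{n,j} = γ_{n,j} / γ_{n,j}(1)`. -/
def η (F : Model U) (j : Fin 2) (n : ℕ) : Measure U :=
  (F.γ j n Set.univ)⁻¹ • F.γ j n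

/-! ### The coupled one-step operator -/

/-- `μ_j(G_n)`. -/
def potMean (F : Model U) (n : ℕ) (μ : Measure (U × U)) (j : Fin 2) : ℝ≥0∞ :=
  ∫⁻ v, ENNReal.ofReal (F.G n (proj j v)) ∂μ

/-- `v ↦ G_{n,j,μ}(u_j) = G_n(u_j) / μ_j(G_n)`. -/
def Gnorm (F : Model U) (n : ℕ) (μ : Measure (U × U)) (j : Fin 2) (v : U × U) : ℝ≥0∞ :=
  ENNReal.ofReal (F.G n (proj j v)) / F.potMean n μ j

/-- `v ↦ Ḡ_{n,μ}(v) = G_{n,1,μ}(u_1) ∧ G_{n,2,μ}(u_2)`. -/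
def Gbar (F : Model U) (n : ℕ) (μ : Measure (U × U)) (v : U × U) : ℝ≥0∞ :=
  min (F.Gnorm n μ 0 v) (F.Gnorm n μ 1 v)

/-- `μ(Ḡ_{n,μ})`, the probability that both coordinates are resampled together. -/
def coupleProb (F : Model U) (n : ℕ) (μ : Measure (U × U)) : ℝ≥0∞ :=
  ∫⁻ v, F.Gbar n μ v ∂μ

/-- `v ↦ (G_{n,j,μ} - Ḡ_{n,μ})(v) / μ(G_{n,j,μ} - Ḡ_{n,μ})`. -/
def resid (F : Model U) (n : ℕ) (μ : Measure (U × U)) (j : Fin 2) (v : U × U) : ℝ≥0∞ :=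
  (F.Gnorm n μ j v - F.Gbar n μ v) / ∫⁻ w, (F.Gnorm n μ j w - F.Gbar n μ w) ∂μ

/-- `M̄_n((v, ṽ), ·) = M_n((u_1, ũ_2), ·)` for `v = (u_1, u_2)` and `ṽ = (ũ_1, ũ_2)`. -/
def Mbar (F : Model U) (n : ℕ) : Kernel ((U × U) × (U × U)) (U × U) :=
  (F.M n).comap (fun p => (p.1.1, p.2.2)) (by fun_prop)

instance (F : Model U) (n : ℕ) : IsMarkovKernel (F.Mbar n) := by
  unfold Mbar; infer_instance

/-- The coupled selection-mutation operator from time `n` to time `n + 1`, that is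
`Φ̄_{n+1}(μ)`. -/
def Φbar (F : Model U) (n : ℕ) (μ : Measure (U × U)) : Measure (U × U) :=
  F.coupleProb n μ •
      ((F.coupleProb n μ)⁻¹ • (μ.withDensity (F.Gbar n μ)).bind (F.M (n + 1))) +
    (1 - F.coupleProb n μ) •
      ((μ.prod μ).withDensity fun p => F.resid n μ 0 p.1 * F.resid n μ 1 p.2).bind
        (F.Mbar (n + 1))

end Model

/-- The empirical measure `N⁻¹ ∑_i δ_{x^i}`. -/
def empirical {U : Type u} [MeasurableSpace U] {N : ℕ} (x : Fin N → U × U) : Measure (U × U) :=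
  (N : ℝ≥0∞)⁻¹ • ∑ i, Measure.dirac (x i)

section Facts

variable {U : Type u} [MeasurableSpace U] {N : ℕ}

instance [NeZero N] (x : Fin N → U × U) : IsProbabilityMeasure (empirical x) := by
  constructor
  simp [empirical, ENNReal.inv_mul_cancel, NeZero.ne N]

lemma measurable_empirical : Measurable (empirical (U := U) (N := N)) := by
  refine Measure.measurable_of_measurable_coe _ fun s hs => ?_
  have : (fun x : Fin N → U × U => empirical x s)
      = fun x => (N : ℝ≥0∞)⁻¹ * ∑ i, s.indicator (1 : U × U → ℝ≥0∞) (x i) := by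
    funext x
    simp [empirical, Measure.dirac_apply' _ hs]
  rw [this]
  refine Measurable.const_mul (Finset.measurable_sum _ fun i _ => ?_) _
  exact (measurable_one.indicator hs).comp (measurable_pi_apply i)

/-- The empirical measure as a kernel. -/
def empKernel (U : Type u) [MeasurableSpace U] (N : ℕ) : Kernel (Fin N → U × U) (U × U) :=
  ⟨empirical, measurable_empirical⟩

instance [NeZero N] : IsMarkovKernel (empKernel U N) :=
  ⟨fun x => inferInstanceAs (IsProbabilityMeasure (empirical x))⟩

lemma measurable_lintegral_empirical [NeZero N] {f : (Fin N → U × U) → U × U → ℝ≥0∞}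
    (hf : Measurable (Function.uncurry f)) :
    Measurable fun x => ∫⁻ v, f x v ∂(empirical x) :=
  Measurable.lintegral_kernel_prod_right (κ := empKernel U N) hf

variable (F : Model U) (n : ℕ)

lemma measurable_ofReal_G (j : Fin 2) :
    Measurable fun v : U × U => ENNReal.ofReal (F.G n (proj j v)) :=
  ((F.measurable_G n).comp (measurable_proj j)).ennreal_ofReal

lemma measurable_Gnorm (μ : Measure (U × U)) (j : Fin 2) : Measurable (F.Gnorm n μ j) :=
  (measurable_ofReal_G F n j).div_const _

lemma measurable_Gbar (μ : Measure (U × U)) : Measurable (F.Gbar n μ) :=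
  (measurable_Gnorm F n μ 0).min (measurable_Gnorm F n μ 1)

lemma measurable_resid (μ : Measure (U × U)) (j : Fin 2) : Measurable (F.resid n μ j) :=
  ((measurable_Gnorm F n μ j).sub (measurable_Gbar F n μ)).div_const _

lemma measurable_Gnorm_empirical [NeZero N] (j : Fin 2) :
    Measurable (Function.uncurry fun (x : Fin N → U × U) v => F.Gnorm n (empirical x) j v) := by
  have h : Measurable fun x : Fin N → U × U => F.potMean n (empirical x) j :=
    measurable_lintegral_empirical
      (f := fun _ v => ENNReal.ofReal (F.G n (proj j v)))
      ((measurable_ofReal_G F n j).comp measurable_snd)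
  exact ((measurable_ofReal_G F n j).comp measurable_snd).div (h.comp measurable_fst)

lemma measurable_Gbar_empirical [NeZero N] :
    Measurable (Function.uncurry fun (x : Fin N → U × U) v => F.Gbar n (empirical x) v) :=
  (measurable_Gnorm_empirical F n 0).min (measurable_Gnorm_empirical F n 1)

lemma measurable_coupleProb_empirical [NeZero N] :
    Measurable fun x : Fin N → U × U => F.coupleProb n (empirical x) :=
  measurable_lintegral_empirical (measurable_Gbar_empirical F n)

lemma measurable_resid_empirical [NeZero N] (j : Fin 2) :
    Measurable (Function.uncurry fun (x : Fin N → U × U) v => F.resid n (empirical x) j v) := by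
  have h := (measurable_Gnorm_empirical (N := N) F n j).sub (measurable_Gbar_empirical F n)
  exact h.div ((measurable_lintegral_empirical
    (f := fun x v => F.Gnorm n (empirical x) j v - F.Gbar n (empirical x) v) h).comp
      measurable_fst)

lemma Φbar_apply (μ : Measure (U × U)) [IsProbabilityMeasure μ] {s : Set (U × U)}
    (hs : MeasurableSet s) :
    F.Φbar n μ s = F.coupleProb n μ * ((F.coupleProb n μ)⁻¹ *
        ∫⁻ v, F.Gbar n μ v * F.M (n + 1) v s ∂μ) +
      (1 - F.coupleProb n μ) *
        ∫⁻ v, ∫⁻ w, F.resid n μ 0 v * F.resid n μ 1 w * F.M (n + 1) (v.1, w.2) s ∂μ ∂μ := by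
  have hr : Measurable fun p : (U × U) × (U × U) => F.resid n μ 0 p.1 * F.resid n μ 1 p.2 :=
    ((measurable_resid F n μ 0).comp measurable_fst).mul
      ((measurable_resid F n μ 1).comp measurable_snd)
  have hM := (F.M (n + 1)).measurable_coe hs
  have hMb := (F.Mbar (n + 1)).measurable_coe hs
  rw [Model.Φbar]
  simp only [Measure.add_apply, Measure.smul_apply, smul_eq_mul]
  rw [Measure.bind_apply hs (F.M (n + 1)).aemeasurable,
    Measure.bind_apply hs (F.Mbar (n + 1)).aemeasurable,
    lintegral_withDensity_eq_lintegral_mul _ (measurable_Gbar F n μ) hM,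
    lintegral_withDensity_eq_lintegral_mul _ hr hMb,
    lintegral_prod _ (hr.mul hMb).aemeasurable]
  rfl

lemma measurable_Φbar_empirical [NeZero N] :
    Measurable fun x : Fin N → U × U => F.Φbar n (empirical x) := by
  refine Measure.measurable_of_measurable_coe _ fun s hs => ?_
  simp only [Φbar_apply F n _ hs]
  have hM := (F.M (n + 1)).measurable_coe hs
  have hc := measurable_coupleProb_empirical (N := N) F n
  refine (hc.mul (hc.inv.mul (measurable_lintegral_empirical
    (f := fun x v => F.Gbar n (empirical x) v * F.M (n + 1) v s)
    ((measurable_Gbar_empirical F n).mul (hM.comp measurable_snd))))).add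
    ((measurable_const.sub hc).mul ?_)
  refine measurable_lintegral_empirical (f := fun x v => ∫⁻ w, F.resid n (empirical x) 0 v *
    F.resid n (empirical x) 1 w * F.M (n + 1) (v.1, w.2) s ∂(empirical x)) ?_
  have h0 := measurable_resid_empirical (N := N) F n 0
  have h1 := measurable_resid_empirical (N := N) F n 1
  have key : Measurable fun q : ((Fin N → U × U) × (U × U)) × (U × U) =>
      F.resid n (empirical q.1.1) 0 q.1.2 * F.resid n (empirical q.1.1) 1 q.2 *
        F.M (n + 1) (q.1.2.1, q.2.2) s :=
    ((h0.comp measurable_fst).mul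
      (h1.comp ((measurable_fst.comp measurable_fst).prodMk measurable_snd))).mul
      (hM.comp (by fun_prop : Measurable fun q : ((Fin N → U × U) × (U × U)) × (U × U) =>
        (q.1.2.1, q.2.2)))
  exact Measurable.lintegral_kernel_prod_right
    (κ := (empKernel U N).comap Prod.fst (measurable_fst (β := U × U)))
    (f := fun (q : (Fin N → U × U) × (U × U)) w => F.resid n (empirical q.1) 0 q.2 *
      F.resid n (empirical q.1) 1 w * F.M (n + 1) (q.2.1, w.2) s) key

lemma potMean_ne_zero (μ : Measure (U × U)) [IsProbabilityMeasure μ] (j : Fin 2) :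
    F.potMean n μ j ≠ 0 := by
  intro h
  rw [Model.potMean, lintegral_eq_zero_iff (measurable_ofReal_G F n j)] at h
  have : ∀ᵐ _ ∂μ, False := by
    filter_upwards [h] with v hv
    have := F.G_pos n (proj j v)
    simp at hv
    linarith
  simp [IsProbabilityMeasure.ne_zero μ] at this

lemma isProbabilityMeasure_Φbar (μ : Measure (U × U)) [IsProbabilityMeasure μ]
    (hfin : ∀ j, F.potMean n μ j ≠ ∞) : IsProbabilityMeasure (F.Φbar n μ) := by
  have hG : ∀ j, ∫⁻ v, F.Gnorm n μ j v ∂μ = 1 := by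
    intro j
    simp only [Model.Gnorm, div_eq_mul_inv]
    rw [lintegral_mul_const _ (measurable_ofReal_G F n j)]
    exact ENNReal.mul_inv_cancel (potMean_ne_zero F n μ j) (hfin j)
  have hle : ∀ j v, F.Gbar n μ v ≤ F.Gnorm n μ j v := by
    intro j v
    fin_cases j
    · exact min_le_left _ _
    · exact min_le_right _ _
  have hc1 : F.coupleProb n μ ≤ 1 := (hG 0) ▸ lintegral_mono (hle 0)
  have hcfin : F.coupleProb n μ ≠ ∞ := ne_top_of_le_ne_top ENNReal.one_ne_top hc1
  have hpos : ∀ v, F.Gbar n μ v ≠ 0 := by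
    intro v
    have h : ∀ j, 0 < F.Gnorm n μ j v := fun j =>
      ENNReal.div_pos (by simpa using F.G_pos n (proj j v)) (hfin j)
    exact (lt_min (h 0) (h 1)).ne'
  have hc0 : F.coupleProb n μ ≠ 0 := by
    intro h
    rw [Model.coupleProb, lintegral_eq_zero_iff (measurable_Gbar F n μ)] at h
    have : ∀ᵐ _ ∂μ, False := by
      filter_upwards [h] with v hv
      exact hpos v hv
    simp [IsProbabilityMeasure.ne_zero μ] at this
  have hsub : ∀ j, ∫⁻ w, (F.Gnorm n μ j w - F.Gbar n μ w) ∂μ = 1 - F.coupleProb n μ := by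
    intro j
    rw [lintegral_sub (measurable_Gbar F n μ) hcfin (Filter.Eventually.of_forall (hle j)), hG j]
    rfl
  constructor
  rw [Φbar_apply F n μ MeasurableSet.univ]
  simp only [measure_univ, mul_one]
  have h1 : ∀ v, ∫⁻ w, F.resid n μ 0 v * F.resid n μ 1 w ∂μ
      = F.resid n μ 0 v * ∫⁻ w, F.resid n μ 1 w ∂μ := fun v =>
    lintegral_const_mul _ (measurable_resid F n μ 1)
  simp only [h1]
  rw [lintegral_mul_const _ (measurable_resid F n μ 0)]
  change F.coupleProb n μ * ((F.coupleProb n μ)⁻¹ * F.coupleProb n μ) + _ = 1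
  rw [ENNReal.inv_mul_cancel hc0 hcfin, mul_one]
  by_cases h : 1 - F.coupleProb n μ = 0
  · rw [h, zero_mul, add_zero]
    exact le_antisymm hc1 (tsub_eq_zero_iff_le.mp h)
  · have hr : ∀ j, ∫⁻ w, F.resid n μ j w ∂μ = 1 := by
      intro j
      simp only [Model.resid, div_eq_mul_inv]
      have hm : Measurable fun w => F.Gnorm n μ j w - F.Gbar n μ w :=
        (measurable_Gnorm F n μ j).sub (measurable_Gbar F n μ)
      rw [lintegral_mul_const _ hm, hsub j]
      exact ENNReal.mul_inv_cancel h (ne_top_of_le_ne_top ENNReal.one_ne_top tsub_le_self)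
    rw [hr, hr, mul_one, mul_one]
    exact add_tsub_cancel_of_le hc1

instance [NeZero N] (x : Fin N → U × U) : IsProbabilityMeasure (F.Φbar n (empirical x)) := by
  refine isProbabilityMeasure_Φbar F n _ fun j => ?_
  rw [Model.potMean, empirical, lintegral_smul_measure, lintegral_finsetSum_measure]
  simp only [lintegral_dirac' _ (measurable_ofReal_G F n j), smul_eq_mul]
  exact ENNReal.mul_ne_top (by simp [NeZero.ne N])
    (ENNReal.sum_ne_top.mpr fun i _ => ENNReal.ofReal_ne_top)

lemma measurable_pi_Φbar [NeZero N] :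
    Measurable fun x : Fin N → U × U => Measure.pi fun _ : Fin N => F.Φbar n (empirical x) := by
  refine Measurable.measure_of_isPiSystem_of_isProbabilityMeasure generateFrom_pi.symm
    isPiSystem_pi ?_
  rintro _ ⟨t, ht, rfl⟩
  simp only [Measure.pi_pi]
  refine Finset.measurable_prod _ fun i _ => ?_
  have hti : MeasurableSet (t i) := ht i (Set.mem_univ i)
  exact (Measure.measurable_coe hti).comp (measurable_Φbar_empirical F n)

end Facts

namespace Model

/-! ### The coupled particle filter -/

section Algorithm

variable {U : Type u} [MeasurableSpace U] (F : Model U) (N : ℕ) [NeZero N]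

/-- One step of the coupled particle filter: given the `N` particles at time `n`, the `N` particles
at time `n + 1` are drawn independently from `Φ̄_{n+1}(η̄^N_n)`. -/
def stepKernel (n : ℕ) : Kernel (Fin N → U × U) (Fin N → U × U) :=
  ⟨fun x => Measure.pi fun _ : Fin N => F.Φbar n (empirical x), measurable_pi_Φbar F n⟩

instance (n : ℕ) : IsMarkovKernel (F.stepKernel N n) :=
  ⟨fun x => inferInstanceAs
    (IsProbabilityMeasure (Measure.pi fun _ : Fin N => F.Φbar n (empirical x)))⟩

/-- The step, seen as a kernel from the whole past of the particle system. -/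
def histKernel (n : ℕ) : Kernel (Finset.Iic n → Fin N → U × U) (Fin N → U × U) :=
  (F.stepKernel N n).comap (fun h => h ⟨n, Finset.mem_Iic.mpr le_rfl⟩) (measurable_pi_apply _)

instance (n : ℕ) : IsMarkovKernel (F.histKernel N n) := by
  unfold histKernel; infer_instance

/-- The law of the coupled particle filter with `N` particles, on the trajectories
`ω : ℕ → Fin N → U × U`, where `ω p i = (U_{p,1}^i, U_{p,2}^i)`:
`∏_i η_0(dv_0^i) ∏_{p ≥ 1} ∏_i Φ̄_p(η̄^N_{p-1})(dv_p^i)`. -/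
def law : Measure (ℕ → Fin N → U × U) :=
  Kernel.trajMeasure (X := fun _ => Fin N → U × U)
    (Measure.pi fun _ : Fin N => F.η₀) (F.histKernel N)

instance : IsProbabilityMeasure (F.law N) := by
  unfold law; infer_instance

end Algorithm

variable {U : Type u} [MeasurableSpace U]

/-- `η̄^N_{p,j}(G_p)`, the mean of the potential over the particles at time `p`. -/
def empMean (F : Model U) {N : ℕ} (j : Fin 2) (p : ℕ) (ω : ℕ → Fin N → U × U) : ℝ :=
  (N : ℝ)⁻¹ * ∑ i, F.G p (proj j (ω p i))

/-- The estimate `γ^N_{n,j}(1) = ∏_{p=0}^{n-1} η̄^N_{p,j}(G_p)` of the normalising constant. -/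
def ZN (F : Model U) {N : ℕ} (j : Fin 2) (n : ℕ) (ω : ℕ → Fin N → U × U) : ℝ :=
  ∏ p ∈ Finset.range n, F.empMean j p ω

end Model

/-- The total variation distance `‖μ - ν‖_tv = sup_A |μ(A) - ν(A)|` of probability measures. -/
def tv {E : Type u} [MeasurableSpace E] (μ ν : Measure E) : ℝ :=
  ⨆ A : {A : Set E // MeasurableSet A}, |μ.real A - ν.real A|

/-- `|||M₁ - M₂|||`, the supremum of `|M₁(φ)(x) - M₂(φ)(x)|` over all points `x` and all bounded
Lipschitz `φ` with sup norm `‖φ‖ ≤ 1` (and arbitrary Lipschitz constant). -/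
def kernelDist {E : Type u} [MetricSpace E] [MeasurableSpace E] (M₁ M₂ : Kernel E E) : ℝ :=
  sSup {r | ∃ (φ : E →ᵇ ℝ) (x : E), ‖φ‖ ≤ 1 ∧ (∃ L : ℝ≥0, LipschitzWith L φ) ∧
    r = |∫ y, φ y ∂(M₁ x) - ∫ y, φ y ∂(M₂ x)|}

namespace Model

variable {U : Type u} [MetricSpace U] [MeasurableSpace U]

/-- Assumption (A1): `c⁻¹ < G_n < c` and `G_n` is `C`-Lipschitz, for all `n ≥ 0`. -/
structure A1 (F : Model U) (c C : ℝ) : Prop where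
  bounded : ∀ n x, c⁻¹ < F.G n x ∧ F.G n x < c
  lipschitz : ∀ n x x', |F.G n x - F.G n x'| ≤ C * dist x x'

/-- Assumption (A2): `|M_{n,j}(φ)(u) - M_{n,j}(φ)(u')| ≤ C_n ‖φ‖ |u - u'|` for all `n ≥ 1`, both `j`
and all bounded Lipschitz `φ`, where `‖φ‖` is the sup norm (and `C_n` is written `Λ n`). -/
def A2 (F : Model U) (Λ : ℕ → ℝ) : Prop :=
  ∀ n, 1 ≤ n → ∀ (j : Fin 2) (φ : U →ᵇ ℝ), (∃ L : ℝ≥0, LipschitzWith L φ) → ∀ u u' : U,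
    |∫ y, φ y ∂(F.Mj j n u) - ∫ y, φ y ∂(F.Mj j n u')| ≤ Λ n * ‖φ‖ * dist u u'

/-- `B(n) = (∑_{p=0}^n {E[{|U_{p,1}^1 - U_{p,2}^1| ∧ 1}²]^{1/2} + ‖η_{p,1} - η_{p,2}‖_tv}
+ ∑_{p=1}^n |||M_{p,1} - M_{p,2}|||)²`, the expectation being taken under the law of the coupled
particle filter with `N` particles; `0 : Fin N` is the first particle. -/
def B (F : Model U) (N : ℕ) [NeZero N] (n : ℕ) : ℝ :=
  (∑ p ∈ Finset.range (n + 1),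
      (√(∫ ω, (min (dist (ω p 0).1 (ω p 0).2) 1) ^ 2 ∂(F.law N)) + tv (F.η 0 p) (F.η 1 p)) +
    ∑ p ∈ Finset.Icc 1 n, kernelDist (F.Mj 0 p) (F.Mj 1 p)) ^ 2

/-- `B̄(0) = K(0) B(0)` and `B̄(n) = K(n) [B(n-1) + B̄(n-1) + ‖η_{n-1,1} - η_{n-1,2}‖_tv²
+ (γ_{n-1,1}(1) - γ_{n-1,2}(1))²]` for `n ≥ 1`, with constants `K(n)`. -/
def Bbar (F : Model U) (N : ℕ) [NeZero N] (K : ℕ → ℝ) : ℕ → ℝ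
  | 0 => K 0 * F.B N 0
  | n + 1 => K (n + 1) *
      (F.B N n + Bbar F N K n + tv (F.η 0 n) (F.η 1 n) ^ 2 + (F.Z 0 n - F.Z 1 n) ^ 2)

end Model

end CoupledPF

end

/-! Write e(n) for the centred difference of the two estimated normalising constants. Expanding the
products (`sq_ZN_succ_sub_le`), e(n+1) is a sum of four terms: a bounded multiple of e(n);
(γ_{n,1}(1) - γ_{n,2}(1)) times the error of one marginal filter at G_n; a bounded multiple of the
difference of the errors of the two filters at G_n; and η_{n,1}(G_n) - η_{n,2}(G_n) times the error
of one normalising constant. Squared and averaged, the first is handled by induction. The second and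
fourth are a squared discrepancy of the two levels times a standard O(1/N) error
(`integral_sq_dev_le`, `integral_sq_ZN_sub_le`). This leaves the third.

The core is therefore `integral_sq_diffDev_le`: for φ bounded by a and a-Lipschitz, the difference
of the two filter errors has mean square at most a constant times a² B_N(n)/N. It is proved by
induction on n, conditioning on the previous particles. The new ones are i.i.d., so the conditional
mean square is a variance plus a squared bias. The variance is that of φ(u_1) - φ(u_2), which the
truncated distance of the pair controls.

For the bias, each marginal of the coupled selection-mutation operator is the usual single-filter
update (`Φbar_preimage_proj`, a maximal coupling argument). The bias of filter j is then the
previous error at the new test function `centred`, divided by the empirical mean of G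
(`integral_Φbar_empirical_sub`). Subtracting the two ratios gives four terms again (`sq_bias_le`),
each either covered by the induction hypothesis or a level discrepancy times a single-filter error.
The induction closes because (A2) bounds the Lipschitz constant of M(φ) by the supremum norm of φ,
so `centred` is again bounded and Lipschitz at the scale of a. -/

namespace CoupledPF

universe u

/-! ### Integration against kernels and total variation. -/

section Basics

variable {E : Type u} [MeasurableSpace E]

lemma integrable_of_abs_le {μ : Measure E} [IsFiniteMeasure μ] {f : E → ℝ} {a : ℝ}
    (hf : Measurable f) (ha : ∀ x, |f x| ≤ a) : Integrable f μ :=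
  Integrable.of_bound hf.aestronglyMeasurable a (Filter.Eventually.of_forall ha)

lemma abs_integral_le_of_abs_le {μ : Measure E} [IsProbabilityMeasure μ] {f : E → ℝ} {a : ℝ}
    (ha : ∀ x, |f x| ≤ a) : |∫ x, f x ∂μ| ≤ a := by
  simpa using norm_integral_le_of_norm_le_const (μ := μ) (f := f)
    (Filter.Eventually.of_forall ha)

lemma measurable_integral_kernel {E' : Type*} [MeasurableSpace E'] (κ : Kernel E E')
    [IsSFiniteKernel κ] {f : E' → ℝ} (hf : Measurable f) :
    Measurable fun x => ∫ y, f y ∂(κ x) :=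
  (hf.stronglyMeasurable.integral_kernel (κ := κ)).measurable

lemma integral_bind_kernel {E E' : Type*} [MeasurableSpace E] [MeasurableSpace E']
    (κ : Kernel E E') [IsMarkovKernel κ] (μ : Measure E) [IsFiniteMeasure μ] {φ : E' → ℝ} {a : ℝ}
    (hφ : Measurable φ) (ha : ∀ x, |φ x| ≤ a) :
    ∫ y, φ y ∂(μ.bind κ) = ∫ x, ∫ y, φ y ∂(κ x) ∂μ := by
  have h := Measure.comp_eq_comp_const_apply (μ := μ) (κ := κ)
  have hfin : IsFiniteMeasure ((κ ∘ₖ Kernel.const Unit μ) ()) := by rw [← h]; infer_instance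
  rw [h, Kernel.integral_comp (integrable_of_abs_le hφ ha), Kernel.const_apply]

lemma integral_withDensity_bind (κ : Kernel E E) [IsMarkovKernel κ] (μ : Measure E)
    [IsFiniteMeasure μ] {g φ : E → ℝ} {a b : ℝ} (hg : Measurable g) (hg0 : ∀ x, 0 ≤ g x)
    (hgb : ∀ x, g x ≤ b) (hφ : Measurable φ) (ha : ∀ x, |φ x| ≤ a) :
    ∫ y, φ y ∂((μ.withDensity fun x => ENNReal.ofReal (g x)).bind κ)
      = ∫ x, g x * ∫ y, φ y ∂(κ x) ∂μ := by
  have hint : Integrable g μ := integrable_of_abs_le hg (a := b) fun x => by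
    rw [abs_of_nonneg (hg0 x)]; exact hgb x
  have : IsFiniteMeasure (μ.withDensity fun x => ENNReal.ofReal (g x)) :=
    isFiniteMeasure_withDensity_ofReal hint.2
  rw [integral_bind_kernel κ _ hφ ha,
    integral_withDensity_eq_integral_toReal_smul hg.ennreal_ofReal (by simp)]
  simp [ENNReal.toReal_ofReal (hg0 _)]

lemma tv_bddAbove (μ ν : Measure E) [IsProbabilityMeasure μ] [IsProbabilityMeasure ν] :
    BddAbove (Set.range fun A : {A : Set E // MeasurableSet A} => |μ.real A - ν.real A|) := by
  refine ⟨1, ?_⟩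
  rintro _ ⟨A, rfl⟩
  have h1 := measureReal_le_one (μ := μ) (s := A.1)
  have h2 := measureReal_le_one (μ := ν) (s := A.1)
  have h3 := measureReal_nonneg (μ := μ) (s := A.1)
  have h4 := measureReal_nonneg (μ := ν) (s := A.1)
  exact abs_le.mpr ⟨by linarith, by linarith⟩

lemma tv_nonneg (μ ν : Measure E) : 0 ≤ tv μ ν :=
  Real.iSup_nonneg fun _ => abs_nonneg _

lemma abs_measureReal_sub_le_tv (μ ν : Measure E) [IsProbabilityMeasure μ]
    [IsProbabilityMeasure ν] {A : Set E} (hA : MeasurableSet A) :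
    |μ.real A - ν.real A| ≤ tv μ ν :=
  le_ciSup (tv_bddAbove μ ν) (⟨A, hA⟩ : {A : Set E // MeasurableSet A})

lemma integrableOn_measureReal_superlevel (μ : Measure E) [IsProbabilityMeasure μ] (g : E → ℝ)
    (b : ℝ) : IntegrableOn (fun t => μ.real {x | t ≤ g x}) (Set.Ioc 0 b) := by
  have hanti : Antitone fun t : ℝ => μ.real {x | t ≤ g x} := fun s t hst =>
    measureReal_mono fun x hx => le_trans hst hx
  exact Measure.integrableOn_of_bounded (M := 1) (by simp)
    hanti.measurable.aestronglyMeasurable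
    (Filter.Eventually.of_forall fun t => by
      rw [Real.norm_of_nonneg measureReal_nonneg]; exact measureReal_le_one)

/-- Layer cake: f + a takes values in [0, 2a], so its mean is the integral over (0, 2a] of the
masses of its superlevel sets. For each such set the two masses differ by at most the total
variation distance. -/
lemma abs_integral_sub_le_tv (μ ν : Measure E) [IsProbabilityMeasure μ] [IsProbabilityMeasure ν]
    {f : E → ℝ} {a : ℝ} (hf : Measurable f) (ha : ∀ x, |f x| ≤ a) :
    |∫ x, f x ∂μ - ∫ x, f x ∂ν| ≤ 2 * a * tv μ ν := by
  obtain ⟨x₀⟩ : Nonempty E := μ.nonempty_of_neZero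
  have ha0 : 0 ≤ a := (abs_nonneg _).trans (ha x₀)
  have key : ∀ (ρ : Measure E) [IsProbabilityMeasure ρ],
      ∫ x, f x ∂ρ = (∫ t in Set.Ioc 0 (2 * a), ρ.real {x | t ≤ f x + a}) - a := by
    intro ρ _
    have hfi : Integrable f ρ := integrable_of_abs_le hf ha
    rw [← Integrable.integral_eq_integral_Ioc_meas_le (μ := ρ) (f := fun x => f x + a)
      (hfi.add (integrable_const _))
      (Filter.Eventually.of_forall fun x => by have := abs_le.mp (ha x); simp; linarith)
      (Filter.Eventually.of_forall fun x => by have := abs_le.mp (ha x); simp; linarith)]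
    rw [integral_add hfi (integrable_const _)]
    simp
  rw [key μ, key ν, sub_sub_sub_cancel_right, ← integral_sub
    (integrableOn_measureReal_superlevel μ _ _) (integrableOn_measureReal_superlevel ν _ _)]
  have h := norm_setIntegral_le_of_norm_le_const (μ := volume) (s := Set.Ioc (0:ℝ) (2 * a))
    (f := fun t => μ.real {x | t ≤ f x + a} - ν.real {x | t ≤ f x + a}) (C := tv μ ν)
    measure_Ioc_lt_top
    fun t _ => abs_measureReal_sub_le_tv μ ν (measurableSet_le measurable_const (by fun_prop))
  simp only [Real.norm_eq_abs, Real.volume_real_Ioc] at h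
  rw [sub_zero, max_eq_left (by linarith)] at h
  linarith

end Basics

/-! ### The kernel distance and (A2) on explicit test functions. -/

section KernelDist

variable {U : Type u} [MetricSpace U] [MeasurableSpace U]

lemma kernelDist_nonneg (M₁ M₂ : Kernel U U) : 0 ≤ kernelDist M₁ M₂ := by
  refine Real.sSup_nonneg ?_
  rintro _ ⟨_, _, _, _, rfl⟩
  exact abs_nonneg _

/-- Rescaling by a⁻¹ gives an admissible test function. The value of L plays no part in the bound
because the supremum runs over all Lipschitz constants. -/
lemma abs_integral_sub_le_kernelDist (M₁ M₂ : Kernel U U) [IsMarkovKernel M₁]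
    [IsMarkovKernel M₂] {φ : U → ℝ} {a L : ℝ} (ha : 0 < a) (hφ : ∀ x, |φ x| ≤ a)
    (hL : ∀ x y, |φ x - φ y| ≤ L * dist x y) (x : U) :
    |∫ y, φ y ∂(M₁ x) - ∫ y, φ y ∂(M₂ x)| ≤ a * kernelDist M₁ M₂ := by
  have hlip : LipschitzWith (L / a).toNNReal fun y => a⁻¹ * φ y := by
    refine LipschitzWith.of_dist_le' fun y z => ?_
    rw [Real.dist_eq, ← mul_sub, abs_mul, abs_of_pos (inv_pos.mpr ha), div_mul_eq_mul_div,
      div_eq_inv_mul]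
    gcongr
    exact hL y z
  have hb : ∀ y, ‖a⁻¹ * φ y‖ ≤ 1 := fun y => by
    rw [Real.norm_eq_abs, abs_mul, abs_of_pos (inv_pos.mpr ha), inv_mul_le_iff₀ ha, mul_one]
    exact hφ y
  let ψ : U →ᵇ ℝ := BoundedContinuousFunction.ofNormedAddCommGroup _ hlip.continuous 1 hb
  have hψ : ‖ψ‖ ≤ 1 :=
    BoundedContinuousFunction.norm_ofNormedAddCommGroup_le (α := U) _ zero_le_one hb
  -- Boundedness is essential: the real `sSup` of an unbounded set is 0 by convention.
  have hbdd : BddAbove {r | ∃ (φ : U →ᵇ ℝ) (x : U), ‖φ‖ ≤ 1 ∧ (∃ L : ℝ≥0, LipschitzWith L φ) ∧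
      r = |∫ y, φ y ∂(M₁ x) - ∫ y, φ y ∂(M₂ x)|} := by
    refine ⟨2, ?_⟩
    rintro _ ⟨χ, z, hχ, _, rfl⟩
    have h1 := abs_integral_le_of_abs_le (μ := M₁ z) fun y => (χ.norm_coe_le_norm y).trans hχ
    have h2 := abs_integral_le_of_abs_le (μ := M₂ z) fun y => (χ.norm_coe_le_norm y).trans hχ
    rw [abs_le] at h1 h2 ⊢
    exact ⟨by linarith, by linarith⟩
  have h := le_csSup hbdd ⟨ψ, x, hψ, ⟨_, hlip⟩, rfl⟩
  change |∫ y, a⁻¹ * φ y ∂(M₁ x) - ∫ y, a⁻¹ * φ y ∂(M₂ x)| ≤ kernelDist M₁ M₂ at h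
  rwa [integral_const_mul, integral_const_mul, ← mul_sub, abs_mul, abs_of_pos (inv_pos.mpr ha),
    inv_mul_le_iff₀ ha] at h

/-- L disappears from the conclusion: the kernel turns a supremum bound into a Lipschitz bound. This
keeps Lipschitz constants under control through the inductions. -/
lemma Model.A2.abs_sub_le {F : Model U} {Λ : ℕ → ℝ} (h : F.A2 Λ) (hΛ : ∀ n, 0 < Λ n) {n : ℕ}
    (hn : 1 ≤ n)
    (j : Fin 2) {φ : U → ℝ} {a L : ℝ} (ha : 0 ≤ a) (hφ : ∀ x, |φ x| ≤ a)
    (hL : ∀ x y, |φ x - φ y| ≤ L * dist x y) (u u' : U) :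
    |∫ y, φ y ∂(F.Mj j n u) - ∫ y, φ y ∂(F.Mj j n u')| ≤ Λ n * a * dist u u' := by
  have hlip : LipschitzWith L.toNNReal φ := LipschitzWith.of_dist_le' fun y z => hL y z
  refine (h n hn j (BoundedContinuousFunction.ofNormedAddCommGroup φ hlip.continuous a hφ)
    ⟨_, hlip⟩ u u').trans ?_
  have := BoundedContinuousFunction.norm_ofNormedAddCommGroup_le (α := U)
    (f := φ) hlip.continuous ha hφ
  have := hΛ n
  gcongr

end KernelDist

/-! ### Mean square error of i.i.d. empirical averages. -/

section IID

variable {E : Type u} {N : ℕ}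

/-- The empirical average `N⁻¹ ∑_i f(x^i)`. -/
noncomputable def empAvg (f : E → ℝ) (x : Fin N → E) : ℝ := (N : ℝ)⁻¹ * ∑ i, f (x i)

lemma empAvg_sub (f g : E → ℝ) (x : Fin N → E) :
    empAvg (fun v => f v - g v) x = empAvg f x - empAvg g x := by
  simp [empAvg, Finset.sum_sub_distrib, mul_sub]

lemma empAvg_const_mul (r : ℝ) (f : E → ℝ) (x : Fin N → E) :
    empAvg (fun v => r * f v) x = r * empAvg f x := by
  simp only [empAvg, ← Finset.mul_sum]; ring

lemma empAvg_const [NeZero N] (r : ℝ) (x : Fin N → E) : empAvg (fun _ => r) x = r := by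
  simp [empAvg, NeZero.ne N]

lemma empAvg_mono {f g : E → ℝ} (h : ∀ v, f v ≤ g v) (x : Fin N → E) :
    empAvg f x ≤ empAvg g x := by
  unfold empAvg
  gcongr
  exact h _

lemma abs_empAvg_le [NeZero N] {f : E → ℝ} {a : ℝ} (h : ∀ v, |f v| ≤ a) (x : Fin N → E) :
    |empAvg f x| ≤ a :=
  abs_le.mpr ⟨by simpa [empAvg_const] using empAvg_mono (fun v => (abs_le.mp (h v)).1) x,
    by simpa [empAvg_const] using empAvg_mono (fun v => (abs_le.mp (h v)).2) x⟩

variable [MeasurableSpace E]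

lemma measurable_empAvg {f : E → ℝ} (hf : Measurable f) :
    Measurable (empAvg f : (Fin N → E) → ℝ) :=
  (Finset.measurable_sum _ fun i _ => hf.comp (measurable_pi_apply i)).const_mul _

lemma integral_empAvg_pi [NeZero N] (P : Measure E) [IsProbabilityMeasure P] {ψ : E → ℝ} {a : ℝ}
    (hψ : Measurable ψ) (ha : ∀ v, |ψ v| ≤ a) :
    ∫ y, empAvg ψ y ∂(Measure.pi fun _ : Fin N => P) = ∫ v, ψ v ∂P := by
  simp only [empAvg]
  have hi : ∀ i ∈ Finset.univ, Integrable (fun y : Fin N → E => ψ (y i))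
      (Measure.pi fun _ : Fin N => P) := fun i _ =>
    integrable_of_abs_le (hψ.comp (measurable_pi_apply i)) fun y => ha (y i)
  rw [integral_const_mul, integral_finsetSum _ hi]
  simp only [integral_comp_eval (μ := fun _ : Fin N => P) hψ.aestronglyMeasurable]
  simp [NeZero.ne N]

/-- Bias-variance decomposition about m, with the variance of ψ bounded by its second moment. -/
lemma integral_sq_empAvg_sub_le [NeZero N] (P : Measure E) [IsProbabilityMeasure P] {ψ : E → ℝ}
    {a : ℝ} (hψ : Measurable ψ) (ha : ∀ v, |ψ v| ≤ a) (m : ℝ) :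
    ∫ y, (empAvg ψ y - m) ^ 2 ∂(Measure.pi fun _ : Fin N => P)
      ≤ (∫ v, ψ v ^ 2 ∂P) / N + (∫ v, ψ v ∂P - m) ^ 2 := by
  have hN : (0:ℝ) < N := by exact_mod_cast Nat.pos_of_ne_zero (NeZero.ne N)
  have hmem : MemLp ψ 2 P := MemLp.of_bound hψ.aestronglyMeasurable a
    (Filter.Eventually.of_forall ha)
  have hem : MemLp (empAvg ψ : (Fin N → E) → ℝ) 2 (Measure.pi fun _ : Fin N => P) :=
    MemLp.of_bound (measurable_empAvg hψ).aestronglyMeasurable a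
      (Filter.Eventually.of_forall (abs_empAvg_le ha))
  have hvar : Var[(empAvg ψ : (Fin N → E) → ℝ); Measure.pi fun _ : Fin N => P]
      = Var[ψ; P] / N := by
    have h := variance_sum_pi (μ := fun _ : Fin N => P) (X := fun _ => ψ) fun _ => hmem
    have he : (empAvg ψ : (Fin N → E) → ℝ) = fun y => (N : ℝ)⁻¹ *
        (∑ i : Fin N, fun ω : Fin N → E => ψ (ω i)) y := by
      funext y; simp [empAvg]
    rw [he, variance_const_mul, h]
    simp only [Finset.sum_const, Finset.card_univ, Fintype.card_fin, nsmul_eq_mul]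
    field_simp
  have h1 := variance_eq_sub (hem.sub (memLp_const m))
  have h2 : Var[(empAvg ψ : (Fin N → E) → ℝ) - fun _ => m; Measure.pi fun _ : Fin N => P]
      = Var[(empAvg ψ : (Fin N → E) → ℝ); Measure.pi fun _ : Fin N => P] :=
    variance_sub_const (measurable_empAvg hψ).aestronglyMeasurable m
  have h3 : ∫ y, (empAvg ψ y - m) ∂(Measure.pi fun _ : Fin N => P) = ∫ v, ψ v ∂P - m := by
    rw [integral_sub (integrable_of_abs_le (measurable_empAvg hψ) (abs_empAvg_le ha))
      (integrable_const _), integral_empAvg_pi P hψ ha]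
    simp
  have h4 : Var[ψ; P] ≤ ∫ v, ψ v ^ 2 ∂P := by
    simpa using variance_le_expectation_sq hψ.aestronglyMeasurable
  simp only [Pi.sub_apply, Pi.pow_apply] at h1
  rw [h2, hvar, h3] at h1
  have h5 : Var[ψ; P] / N ≤ (∫ v, ψ v ^ 2 ∂P) / N := by gcongr
  linarith

lemma integral_empirical {U : Type u} [MeasurableSpace U] [NeZero N] (x : Fin N → U × U)
    {f : U × U → ℝ} (hf : Measurable f) : ∫ v, f v ∂(empirical x) = empAvg f x := by
  rw [empirical, integral_smul_measure, integral_finsetSum_measure]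
  · simp [integral_dirac' _ _ hf.stronglyMeasurable, empAvg]
  · intro i _
    exact integrable_dirac' hf.stronglyMeasurable (by simp)

end IID

namespace Model

/-! ### One-time marginals of the particle system. -/

section Law

variable {U : Type u} [MeasurableSpace U] (F : Model U) (N : ℕ) [NeZero N]

lemma law_map_zero :
    (F.law N).map (fun ω => ω 0) = Measure.pi fun _ : Fin N => F.η₀ := by
  have h0 : (F.law N).map (Preorder.frestrictLe 0)
      = (Measure.pi fun _ : Fin N => F.η₀).map
        (MeasurableEquiv.piUnique fun _ : Finset.Iic 0 => (Fin N → U × U)).symm := by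
    rw [law, Kernel.trajMeasure, Measure.map_comp _ _ (by fun_prop),
      Kernel.traj_map_frestrictLe, Kernel.partialTraj_self, Measure.id_comp]
  have h1 : (fun ω : ℕ → Fin N → U × U => ω 0)
      = (fun h : (Finset.Iic 0 → Fin N → U × U) => h ⟨0, Finset.mem_Iic.mpr le_rfl⟩) ∘
        Preorder.frestrictLe (π := fun _ => Fin N → U × U) 0 := rfl
  rw [h1, ← Measure.map_map (by fun_prop) (by fun_prop), h0,
    Measure.map_map (by fun_prop) (by fun_prop)]
  exact Measure.map_id

/-- `histKernel` reads only the last coordinate of the history, so the second marginal of the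
trajectory identity is a Markov chain recursion. -/
lemma law_map_succ (n : ℕ) :
    (F.law N).map (fun ω => ω (n + 1)) =
      ((F.law N).map (fun ω => ω n)).bind (F.stepKernel N n) := by
  have h := Kernel.map_frestrictLe_trajMeasure_compProd_eq_map_trajMeasure
    (X := fun _ => Fin N → U × U) (κ := F.histKernel N)
    (μ₀ := Measure.pi fun _ : Fin N => F.η₀) (a := n)
  have h' := congrArg Measure.snd h
  rw [Measure.snd_compProd, Measure.snd, Measure.map_map (by fun_prop) (by fun_prop)] at h'
  change _ = (F.law N).map (fun ω => ω (n + 1)) at h'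
  rw [← h']
  ext s hs
  rw [Measure.bind_apply hs (Kernel.aemeasurable _), Measure.bind_apply hs (Kernel.aemeasurable _),
    lintegral_map (Kernel.measurable_coe (F.histKernel N n) hs) (by fun_prop),
    lintegral_map (Kernel.measurable_coe (F.stepKernel N n) hs) (measurable_pi_apply n)]
  rfl

lemma integral_law_zero {f : (Fin N → U × U) → ℝ} (hf : Measurable f) :
    ∫ ω, f (ω 0) ∂(F.law N) = ∫ y, f y ∂(Measure.pi fun _ : Fin N => F.η₀) := by
  rw [← law_map_zero, integral_map (measurable_pi_apply 0).aemeasurable hf.aestronglyMeasurable]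

lemma measurable_integral_pi_Φbar (n : ℕ) {f : (Fin N → U × U) → ℝ} (hf : Measurable f) :
    Measurable fun x : Fin N → U × U =>
      ∫ y, f y ∂(Measure.pi fun _ : Fin N => F.Φbar n (empirical x)) :=
  measurable_integral_kernel (F.stepKernel N n) hf

lemma integral_law_succ (n : ℕ) {f : (Fin N → U × U) → ℝ} {a : ℝ} (hf : Measurable f)
    (ha : ∀ x, |f x| ≤ a) :
    ∫ ω, f (ω (n + 1)) ∂(F.law N)
      = ∫ ω, ∫ y, f y ∂(Measure.pi fun _ : Fin N => F.Φbar n (empirical (ω n))) ∂(F.law N) := by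
  have h1 : ∫ ω, f (ω (n + 1)) ∂(F.law N)
      = ∫ y, f y ∂((F.law N).map (fun ω => ω (n + 1))) := by
    rw [integral_map (measurable_pi_apply (n + 1)).aemeasurable hf.aestronglyMeasurable]
  have : IsProbabilityMeasure ((F.law N).map (fun ω => ω n)) :=
    Measure.isProbabilityMeasure_map (measurable_pi_apply n).aemeasurable
  rw [h1, law_map_succ, integral_bind_kernel _ _ hf ha,
    integral_map (measurable_pi_apply n).aemeasurable
      (measurable_integral_kernel (F.stepKernel N n) hf).aestronglyMeasurable]
  rfl

end Law

/-! ### Marginals of the coupled selection-mutation operator. -/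

section Marginals

variable {U : Type u} [MeasurableSpace U] (F : Model U) (n : ℕ)

lemma lintegral_Gnorm (μ : Measure (U × U)) [IsProbabilityMeasure μ] (j : Fin 2)
    (hfin : F.potMean n μ j ≠ ∞) : ∫⁻ v, F.Gnorm n μ j v ∂μ = 1 := by
  simp only [Gnorm, div_eq_mul_inv]
  rw [lintegral_mul_const _ (measurable_ofReal_G F n j)]
  exact ENNReal.mul_inv_cancel (potMean_ne_zero F n μ j) hfin

lemma Gbar_le_Gnorm (μ : Measure (U × U)) (j : Fin 2) (v : U × U) :
    F.Gbar n μ v ≤ F.Gnorm n μ j v := by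
  fin_cases j
  · exact min_le_left _ _
  · exact min_le_right _ _

lemma coupleProb_le_one (μ : Measure (U × U)) [IsProbabilityMeasure μ]
    (hfin : ∀ j, F.potMean n μ j ≠ ∞) : F.coupleProb n μ ≤ 1 :=
  F.lintegral_Gnorm n μ 0 (hfin 0) ▸ lintegral_mono (F.Gbar_le_Gnorm n μ 0)

lemma coupleProb_ne_zero (μ : Measure (U × U)) [IsProbabilityMeasure μ]
    (hfin : ∀ j, F.potMean n μ j ≠ ∞) : F.coupleProb n μ ≠ 0 := by
  intro h
  rw [coupleProb, lintegral_eq_zero_iff (measurable_Gbar F n μ)] at h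
  have : ∀ᵐ _ ∂μ, False := by
    filter_upwards [h] with v hv
    have h : ∀ j, 0 < F.Gnorm n μ j v := fun j =>
      ENNReal.div_pos (by simpa using F.G_pos n (proj j v)) (hfin j)
    exact (lt_min (h 0) (h 1)).ne' hv
  simp [IsProbabilityMeasure.ne_zero μ] at this

lemma lintegral_Gnorm_sub_Gbar (μ : Measure (U × U)) [IsProbabilityMeasure μ]
    (hfin : ∀ j, F.potMean n μ j ≠ ∞) (j : Fin 2) :
    ∫⁻ w, (F.Gnorm n μ j w - F.Gbar n μ w) ∂μ = 1 - F.coupleProb n μ := by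
  rw [lintegral_sub (measurable_Gbar F n μ)
    (ne_top_of_le_ne_top ENNReal.one_ne_top (F.coupleProb_le_one n μ hfin))
    (Filter.Eventually.of_forall (F.Gbar_le_Gnorm n μ j)), F.lintegral_Gnorm n μ j (hfin j)]
  rfl

lemma lintegral_resid (μ : Measure (U × U)) [IsProbabilityMeasure μ]
    (hfin : ∀ j, F.potMean n μ j ≠ ∞) (h : 1 - F.coupleProb n μ ≠ 0) (j : Fin 2) :
    ∫⁻ w, F.resid n μ j w ∂μ = 1 := by
  simp only [resid, div_eq_mul_inv]
  have hm : Measurable fun w => F.Gnorm n μ j w - F.Gbar n μ w :=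
    (measurable_Gnorm F n μ j).sub (measurable_Gbar F n μ)
  rw [lintegral_mul_const _ hm, F.lintegral_Gnorm_sub_Gbar n μ hfin j]
  exact ENNReal.mul_inv_cancel h (ne_top_of_le_ne_top ENNReal.one_ne_top tsub_le_self)

/-- The prefactor is exactly the normaliser of `resid` and cancels it. If it vanishes, the
nonnegative excess on the right has integral 0 too. -/
lemma one_sub_coupleProb_mul_lintegral_resid (μ : Measure (U × U)) [IsProbabilityMeasure μ]
    (hfin : ∀ j, F.potMean n μ j ≠ ∞) (j : Fin 2) {k : U × U → ℝ≥0∞} (hk : Measurable k)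
    (hk1 : ∀ v, k v ≤ 1) :
    (1 - F.coupleProb n μ) * ∫⁻ v, F.resid n μ j v * k v ∂μ
      = ∫⁻ v, (F.Gnorm n μ j v - F.Gbar n μ v) * k v ∂μ := by
  have hsub := F.lintegral_Gnorm_sub_Gbar n μ hfin j
  by_cases h : 1 - F.coupleProb n μ = 0
  · rw [h, zero_mul]
    refine le_antisymm zero_le ?_
    rw [← h, ← hsub]
    exact lintegral_mono fun v => mul_le_of_le_one_right' (hk1 v)
  · have htop : 1 - F.coupleProb n μ ≠ ∞ :=
      ne_top_of_le_ne_top ENNReal.one_ne_top tsub_le_self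
    have hm : Measurable fun v => F.resid n μ j v * k v := (measurable_resid F n μ j).mul hk
    rw [← lintegral_const_mul _ hm]
    refine lintegral_congr fun v => ?_
    rw [resid, hsub, ← mul_assoc, ENNReal.mul_div_cancel h htop]

/-- The common part contributes Ḡ. In the independent part the residual of the other coordinate
integrates to 1, leaving G_j - Ḡ. The sum is G_j, whatever the coupling does. -/
lemma Φbar_preimage_proj (μ : Measure (U × U)) [IsProbabilityMeasure μ]
    (hfin : ∀ j, F.potMean n μ j ≠ ∞) (j : Fin 2) {s : Set U} (hs : MeasurableSet s) :
    F.Φbar n μ (proj j ⁻¹' s)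
      = ∫⁻ v, F.Gnorm n μ j v * F.Mj j (n + 1) (proj j v) s ∂μ := by
  have hM : ∀ v, F.M (n + 1) v (proj j ⁻¹' s) = F.Mj j (n + 1) (proj j v) s := fun v => by
    rw [← F.marginal (n + 1) (by omega) j v, Measure.map_apply (measurable_proj j) hs]
  have hk : Measurable fun v : U × U => F.Mj j (n + 1) (proj j v) s :=
    (Kernel.measurable_coe _ hs).comp (measurable_proj j)
  have hk1 : ∀ v : U × U, F.Mj j (n + 1) (proj j v) s ≤ 1 := fun v => prob_le_one
  have hc1 := F.coupleProb_le_one n μ hfin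
  have hcfin : F.coupleProb n μ ≠ ∞ := ne_top_of_le_ne_top ENNReal.one_ne_top hc1
  have hc0 := F.coupleProb_ne_zero n μ hfin
  have hr := measurable_resid F n μ
  have hsecond : (1 - F.coupleProb n μ) * ∫⁻ v, ∫⁻ w, F.resid n μ 0 v * F.resid n μ 1 w *
        F.M (n + 1) (v.1, w.2) (proj j ⁻¹' s) ∂μ ∂μ
      = (1 - F.coupleProb n μ) * ∫⁻ v, F.resid n μ j v * F.Mj j (n + 1) (proj j v) s ∂μ := by
    -- When coupling is certain, `resid` is divided by 0 and need not integrate to 1; the zero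
    -- prefactor makes this harmless.
    by_cases h : 1 - F.coupleProb n μ = 0
    · rw [h, zero_mul, zero_mul]
    congr 1
    simp only [hM]
    obtain rfl | rfl : j = 0 ∨ j = 1 := by omega
    · refine lintegral_congr fun v => ?_
      have : ∀ w, F.resid n μ 0 v * F.resid n μ 1 w * F.Mj 0 (n + 1) (proj 0 (v.1, w.2)) s
          = F.resid n μ 0 v * F.Mj 0 (n + 1) (proj 0 v) s * F.resid n μ 1 w := fun w => by
        rw [mul_right_comm]; rfl
      simp only [this]
      rw [lintegral_const_mul _ (hr 1), F.lintegral_resid n μ hfin h, mul_one]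
    · have : ∀ v w, F.resid n μ 0 v * F.resid n μ 1 w * F.Mj 1 (n + 1) (proj 1 (v.1, w.2)) s
          = F.resid n μ 0 v * (F.resid n μ 1 w * F.Mj 1 (n + 1) (proj 1 w) s) := fun v w => by
        rw [mul_assoc]; rfl
      simp only [this]
      have hm : Measurable fun w => F.resid n μ 1 w * F.Mj 1 (n + 1) (proj 1 w) s :=
        (hr 1).mul hk
      simp only [lintegral_const_mul _ hm]
      rw [lintegral_mul_const _ (hr 0), F.lintegral_resid n μ hfin h, one_mul]
  rw [Φbar_apply F n μ (measurable_proj j hs), hsecond,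
    F.one_sub_coupleProb_mul_lintegral_resid n μ hfin j hk hk1, ← mul_assoc,
    ENNReal.mul_inv_cancel hc0 hcfin, one_mul]
  simp only [hM]
  have hm : Measurable fun v => F.Gbar n μ v * F.Mj j (n + 1) (proj j v) s :=
    (measurable_Gbar F n μ).mul hk
  rw [← lintegral_add_left hm]
  refine lintegral_congr fun v => ?_
  rw [← add_mul, add_tsub_cancel_of_le (F.Gbar_le_Gnorm n μ j v)]

lemma Φbar_map_proj (μ : Measure (U × U)) [IsProbabilityMeasure μ]
    (hfin : ∀ j, F.potMean n μ j ≠ ∞) (j : Fin 2) :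
    (F.Φbar n μ).map (proj j) = (F.potMean n μ j)⁻¹ •
      (((μ.map (proj j)).withDensity fun u => ENNReal.ofReal (F.G n u)).bind
        (F.Mj j (n + 1))) := by
  ext s hs
  have hk := Kernel.measurable_coe (F.Mj j (n + 1)) hs
  have hm : Measurable fun v => ENNReal.ofReal (F.G n (proj j v)) *
      F.Mj j (n + 1) (proj j v) s :=
    ((F.measurable_G n).ennreal_ofReal.mul hk).comp (measurable_proj j)
  rw [Measure.map_apply (measurable_proj j) hs, F.Φbar_preimage_proj n μ hfin j hs,
    Measure.smul_apply, Measure.bind_apply hs (Kernel.aemeasurable _),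
    lintegral_withDensity_eq_lintegral_mul _ (F.measurable_G n).ennreal_ofReal hk,
    lintegral_map ((F.measurable_G n).ennreal_ofReal.mul hk) (measurable_proj j), smul_eq_mul]
  simp only [Pi.mul_apply]
  rw [← lintegral_const_mul _ hm]
  refine lintegral_congr fun v => ?_
  simp only [Gnorm, div_eq_mul_inv]
  ring

lemma integral_Φbar_proj (μ : Measure (U × U)) [IsProbabilityMeasure μ] {c : ℝ}
    (hb : ∀ x, F.G n x ≤ c) (j : Fin 2) {φ : U → ℝ} {a : ℝ}
    (hφ : Measurable φ) (ha : ∀ x, |φ x| ≤ a) :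
    ∫ v, φ (proj j v) ∂(F.Φbar n μ)
      = (∫ v, F.G n (proj j v) * ∫ y, φ y ∂(F.Mj j (n + 1) (proj j v)) ∂μ) /
        ∫ v, F.G n (proj j v) ∂μ := by
  have hint : ∀ j, Integrable (fun v => F.G n (proj j v)) μ := fun j =>
    integrable_of_abs_le ((F.measurable_G n).comp (measurable_proj j)) (a := c) fun v => by
      rw [abs_of_pos (F.G_pos n _)]; exact hb _
  have hpot : ∀ j, F.potMean n μ j = ENNReal.ofReal (∫ v, F.G n (proj j v) ∂μ) := fun j => by
    rw [potMean, ofReal_integral_eq_lintegral_ofReal (hint j)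
      (Filter.Eventually.of_forall fun v => (F.G_pos n _).le)]
  have hprob : IsProbabilityMeasure (μ.map (proj j)) :=
    Measure.isProbabilityMeasure_map (measurable_proj j).aemeasurable
  have hM := measurable_integral_kernel (F.Mj j (n + 1)) hφ
  have hm : Measurable fun u => F.G n u * ∫ y, φ y ∂(F.Mj j (n + 1) u) :=
    (F.measurable_G n).mul hM
  rw [← integral_map (measurable_proj j).aemeasurable hφ.aestronglyMeasurable,
    F.Φbar_map_proj n μ (fun j => by rw [hpot]; exact ENNReal.ofReal_ne_top) j,
    integral_smul_measure, integral_withDensity_bind _ _ (F.measurable_G n)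
      (fun x => (F.G_pos n x).le) hb hφ ha,
    integral_map (measurable_proj j).aemeasurable hm.aestronglyMeasurable, hpot j,
    ENNReal.toReal_inv,
    ENNReal.toReal_ofReal (integral_nonneg fun v => (F.G_pos n _).le), smul_eq_mul, div_eq_inv_mul]

end Marginals

/-! ### Recursions for the exact marginal flow. -/

section FeynmanKac

variable {U : Type u} [MeasurableSpace U] (F : Model U) {c : ℝ}

lemma isFiniteMeasure_γ (hb : ∀ n x, F.G n x ≤ c) (j : Fin 2) (n : ℕ) :
    IsFiniteMeasure (F.γ j n) := by
  induction n with
  | zero => rw [γ]; infer_instance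
  | succ n ih =>
    have hint : Integrable (F.G n) (F.γ j n) :=
      integrable_of_abs_le (F.measurable_G n) (a := c) fun v => by
        rw [abs_of_pos (F.G_pos n _)]; exact hb n _
    have : IsFiniteMeasure ((F.γ j n).withDensity fun u => ENNReal.ofReal (F.G n u)) :=
      isFiniteMeasure_withDensity_ofReal hint.2
    rw [γ]
    infer_instance

lemma integral_γ_succ (hb : ∀ n x, F.G n x ≤ c) (j : Fin 2) (n : ℕ) {φ : U → ℝ} {a : ℝ}
    (hφ : Measurable φ) (ha : ∀ x, |φ x| ≤ a) :
    ∫ u, φ u ∂(F.γ j (n + 1)) = ∫ u, F.G n u * ∫ y, φ y ∂(F.Mj j (n + 1) u) ∂(F.γ j n) := by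
  have := F.isFiniteMeasure_γ hb j n
  rw [γ]
  exact integral_withDensity_bind _ _ (F.measurable_G n) (fun x => (F.G_pos n x).le) (hb n) hφ ha

lemma Z_zero (j : Fin 2) : F.Z j 0 = 1 := by
  have : IsProbabilityMeasure (F.η₀.map (proj j)) :=
    Measure.isProbabilityMeasure_map (measurable_proj j).aemeasurable
  simp [Z, γ]

lemma η_zero (j : Fin 2) : F.η j 0 = F.η₀.map (proj j) := by
  have : IsProbabilityMeasure (F.η₀.map (proj j)) :=
    Measure.isProbabilityMeasure_map (measurable_proj j).aemeasurable
  simp [η, γ]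

lemma integral_η_eq (j : Fin 2) (n : ℕ) (φ : U → ℝ) :
    ∫ u, φ u ∂(F.η j n) = (F.Z j n)⁻¹ * ∫ u, φ u ∂(F.γ j n) := by
  rw [η, integral_smul_measure, ENNReal.toReal_inv, smul_eq_mul, Z, measureReal_def]

lemma Z_succ_eq_integral_γ (hb : ∀ n x, F.G n x ≤ c) (j : Fin 2) (n : ℕ) :
    F.Z j (n + 1) = ∫ u, F.G n u ∂(F.γ j n) := by
  have h := F.integral_γ_succ hb j n (φ := fun _ => 1) (a := 1) measurable_const (by simp)
  simpa [Z] using h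

lemma Z_pos (hb : ∀ n x, F.G n x ≤ c) (j : Fin 2) (n : ℕ) : 0 < F.Z j n := by
  induction n with
  | zero => rw [Z_zero]; exact one_pos
  | succ n ih =>
    have := F.isFiniteMeasure_γ hb j n
    have hint : Integrable (F.G n) (F.γ j n) :=
      integrable_of_abs_le (F.measurable_G n) (a := c) fun v => by
        rw [abs_of_pos (F.G_pos n _)]; exact hb n _
    rw [F.Z_succ_eq_integral_γ hb, integral_pos_iff_support_of_nonneg
      (fun u => (F.G_pos n u).le) hint]
    have : Function.support (F.G n) = Set.univ := by
      ext u; simpa using (F.G_pos n u).ne'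
    rw [this]
    exact pos_of_ne_zero fun h => by simp [Z, measureReal_def, h] at ih

lemma isProbabilityMeasure_η (hb : ∀ n x, F.G n x ≤ c) (j : Fin 2) (n : ℕ) :
    IsProbabilityMeasure (F.η j n) := by
  have := F.isFiniteMeasure_γ hb j n
  have hZ := F.Z_pos hb j n
  refine ⟨?_⟩
  rw [η, Measure.smul_apply, smul_eq_mul]
  refine ENNReal.inv_mul_cancel (fun h => ?_) (measure_ne_top _ _)
  simp [Z, measureReal_def, h] at hZ

lemma Z_succ (hb : ∀ n x, F.G n x ≤ c) (j : Fin 2) (n : ℕ) :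
    F.Z j (n + 1) = F.Z j n * ∫ u, F.G n u ∂(F.η j n) := by
  rw [F.Z_succ_eq_integral_γ hb, integral_η_eq, mul_inv_cancel_left₀ (F.Z_pos hb j n).ne']

lemma integral_η_succ (hb : ∀ n x, F.G n x ≤ c) (j : Fin 2) (n : ℕ) {φ : U → ℝ} {a : ℝ}
    (hφ : Measurable φ) (ha : ∀ x, |φ x| ≤ a) :
    ∫ u, φ u ∂(F.η j (n + 1))
      = (∫ u, F.G n u * ∫ y, φ y ∂(F.Mj j (n + 1) u) ∂(F.η j n)) / ∫ u, F.G n u ∂(F.η j n) := by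
  rw [integral_η_eq, integral_η_eq, integral_η_eq, F.integral_γ_succ hb j n hφ ha,
    ← F.Z_succ_eq_integral_γ hb]
  have := (F.Z_pos hb j n).ne'
  have := (F.Z_pos hb j (n + 1)).ne'
  field_simp

end FeynmanKac

end Model

/-! ### Elementary inequalities. -/

lemma abs_sub_le_two_mul {x y a : ℝ} (hx : |x| ≤ a) (hy : |y| ≤ a) : |x - y| ≤ 2 * a := by
  rw [abs_le] at *; constructor <;> linarith

lemma sq_add_le_two_mul (w x : ℝ) : (w + x) ^ 2 ≤ 2 * (w ^ 2 + x ^ 2) := by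
  nlinarith [sq_nonneg (w - x)]

lemma sq_add_le_four_mul (w x y z : ℝ) :
    (w + x + y + z) ^ 2 ≤ 4 * (w ^ 2 + x ^ 2 + y ^ 2 + z ^ 2) := by
  nlinarith [sq_nonneg (w - x), sq_nonneg (w - y), sq_nonneg (w - z), sq_nonneg (x - y),
    sq_nonneg (x - z), sq_nonneg (y - z)]

lemma sq_le_sq_of_abs_le {x b : ℝ} (h : |x| ≤ b) : x ^ 2 ≤ b ^ 2 :=
  sq_le_sq.mpr (h.trans (le_abs_self b))

namespace Model

/-! ### Particle errors and how they propagate in one step. -/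

section Basic

variable {U : Type u} [MeasurableSpace U] (F : Model U)

/-- The error `η^N_{n,j}(φ) - η_{n,j}(φ)` of the particle approximation. -/
noncomputable def dev {N : ℕ} (j : Fin 2) (n : ℕ) (φ : U → ℝ) (x : Fin N → U × U) : ℝ :=
  empAvg (fun v => φ (proj j v)) x - ∫ u, φ u ∂(F.η j n)

/-- The error of the particle approximation of `η_{n,1}(φ) - η_{n,2}(φ)`. -/
noncomputable def diffDev {N : ℕ} (n : ℕ) (φ : U → ℝ) (x : Fin N → U × U) : ℝ :=
  F.dev 0 n φ x - F.dev 1 n φ x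

/-- The function `G_n (M_{n+1,j}(φ) - η_{n+1,j}(φ))`. -/
noncomputable def centred (j : Fin 2) (n : ℕ) (φ : U → ℝ) (u : U) : ℝ :=
  F.G n u * (∫ y, φ y ∂(F.Mj j (n + 1) u) - ∫ y, φ y ∂(F.η j (n + 1)))

lemma measurable_centred (j : Fin 2) (n : ℕ) {φ : U → ℝ} (hφ : Measurable φ) :
    Measurable (F.centred j n φ) :=
  (F.measurable_G n).mul ((measurable_integral_kernel _ hφ).sub_const _)

lemma measurable_dev {N : ℕ} (j : Fin 2) (n : ℕ) {φ : U → ℝ} (hφ : Measurable φ) :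
    Measurable (F.dev j n φ : (Fin N → U × U) → ℝ) :=
  (measurable_empAvg (hφ.comp (measurable_proj j))).sub_const _

lemma measurable_diffDev {N : ℕ} (n : ℕ) {φ : U → ℝ} (hφ : Measurable φ) :
    Measurable (F.diffDev n φ : (Fin N → U × U) → ℝ) :=
  (F.measurable_dev 0 n hφ).sub (F.measurable_dev 1 n hφ)

variable {c : ℝ} (hb : ∀ n x, F.G n x ≤ c)
include hb

lemma abs_G_le (n : ℕ) (x : U) : |F.G n x| ≤ c := by
  rw [abs_of_pos (F.G_pos n x)]; exact hb n x

lemma abs_dev_le {N : ℕ} [NeZero N] (j : Fin 2) (n : ℕ) {φ : U → ℝ} {a : ℝ}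
    (ha : ∀ u, |φ u| ≤ a) (x : Fin N → U × U) : |F.dev j n φ x| ≤ 2 * a := by
  have := F.isProbabilityMeasure_η hb j n
  exact abs_sub_le_two_mul (abs_empAvg_le (fun v => ha _) x) (abs_integral_le_of_abs_le ha)

lemma abs_diffDev_le {N : ℕ} [NeZero N] (n : ℕ) {φ : U → ℝ} {a : ℝ}
    (ha : ∀ u, |φ u| ≤ a) (x : Fin N → U × U) : |F.diffDev n φ x| ≤ 2 * (2 * a) :=
  abs_sub_le_two_mul (F.abs_dev_le hb 0 n ha x) (F.abs_dev_le hb 1 n ha x)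

lemma integrable_sq_dev (N : ℕ) [NeZero N] (j : Fin 2) (n : ℕ) {φ : U → ℝ} {a : ℝ}
    (hφ : Measurable φ) (ha : ∀ u, |φ u| ≤ a) :
    Integrable (fun ω => F.dev j n φ (ω n) ^ 2) (F.law N) :=
  integrable_of_abs_le (((F.measurable_dev j n hφ).comp (measurable_pi_apply n)).pow_const 2)
    (a := (2 * a) ^ 2) fun ω => by
      rw [abs_sq]; exact sq_le_sq_of_abs_le (F.abs_dev_le hb j n ha _)

lemma integrable_sq_diffDev (N : ℕ) [NeZero N] (n : ℕ) {φ : U → ℝ} {a : ℝ}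
    (hφ : Measurable φ) (ha : ∀ u, |φ u| ≤ a) :
    Integrable (fun ω => F.diffDev n φ (ω n) ^ 2) (F.law N) :=
  integrable_of_abs_le (((F.measurable_diffDev n hφ).comp (measurable_pi_apply n)).pow_const 2)
    (a := (2 * (2 * a)) ^ 2) fun ω => by
      rw [abs_sq]; exact sq_le_sq_of_abs_le (F.abs_diffDev_le hb n ha _)

lemma abs_centred_le (j : Fin 2) (n : ℕ) {φ : U → ℝ} {a : ℝ} (ha : ∀ u, |φ u| ≤ a) (u : U) :
    |F.centred j n φ u| ≤ 2 * c * a := by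
  have := F.isProbabilityMeasure_η hb j (n + 1)
  have h := abs_sub_le_two_mul (abs_integral_le_of_abs_le (μ := F.Mj j (n + 1) u) ha)
    (abs_integral_le_of_abs_le (μ := F.η j (n + 1)) ha)
  rw [centred, abs_mul]
  calc _ ≤ c * (2 * a) := mul_le_mul (F.abs_G_le hb n u) h (abs_nonneg _)
        ((F.G_pos n u).le.trans (hb n u))
    _ = 2 * c * a := by ring

lemma integral_G_pos (μ : Measure U) [IsProbabilityMeasure μ] (n : ℕ) :
    0 < ∫ u, F.G n u ∂μ := by
  rw [integral_pos_iff_support_of_nonneg (fun u => (F.G_pos n u).le)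
    (integrable_of_abs_le (F.measurable_G n) (F.abs_G_le hb n))]
  have : Function.support (F.G n) = Set.univ := by
    ext u; simpa using (F.G_pos n u).ne'
  simp [this]

/-- This restates the recursion for η_{n+1}(φ) as a ratio of η_n-integrals. The error at `centred`
is thus a plain empirical average. -/
lemma integral_centred (j : Fin 2) (n : ℕ) {φ : U → ℝ} {a : ℝ} (hφ : Measurable φ)
    (ha : ∀ u, |φ u| ≤ a) : ∫ u, F.centred j n φ u ∂(F.η j n) = 0 := by
  have := F.isProbabilityMeasure_η hb j n
  have hG := integrable_of_abs_le (μ := F.η j n) (F.measurable_G n) (F.abs_G_le hb n)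
  have hM : Integrable (fun u => F.G n u * ∫ y, φ y ∂(F.Mj j (n + 1) u)) (F.η j n) :=
    hG.mul_bdd (c := a) (measurable_integral_kernel _ hφ).aestronglyMeasurable
      (Filter.Eventually.of_forall fun u => abs_integral_le_of_abs_le ha)
  simp only [centred, mul_sub]
  rw [integral_sub hM (hG.mul_const _), integral_mul_const, F.integral_η_succ hb j n hφ ha,
    mul_div_cancel₀ _ (F.integral_G_pos hb _ n).ne', sub_self]

lemma dev_centred {N : ℕ} (j : Fin 2) (n : ℕ) {φ : U → ℝ} {a : ℝ} (hφ : Measurable φ)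
    (ha : ∀ u, |φ u| ≤ a) (x : Fin N → U × U) :
    F.dev j n (F.centred j n φ) x = empAvg (fun v => F.centred j n φ (proj j v)) x := by
  rw [dev, F.integral_centred hb j n hφ ha, sub_zero]

/-- The conditional bias at time n + 1 becomes an error at time n for another test function;
centring by η_{n+1}(φ) absorbs the ratio into one numerator. -/
lemma integral_Φbar_empirical_sub {N : ℕ} [NeZero N] (j : Fin 2) (n : ℕ) {φ : U → ℝ} {a : ℝ}
    (hφ : Measurable φ) (ha : ∀ u, |φ u| ≤ a) (x : Fin N → U × U)
    (hpos : 0 < empAvg (fun v => F.G n (proj j v)) x) :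
    ∫ v, φ (proj j v) ∂(F.Φbar n (empirical x)) - ∫ u, φ u ∂(F.η j (n + 1))
      = F.dev j n (F.centred j n φ) x / empAvg (fun v => F.G n (proj j v)) x := by
  have hM := measurable_integral_kernel (F.Mj j (n + 1)) hφ
  have hm : Measurable fun v : U × U =>
      F.G n (proj j v) * ∫ y, φ y ∂(F.Mj j (n + 1) (proj j v)) :=
    ((F.measurable_G n).mul hM).comp (measurable_proj j)
  have hG : Measurable fun v : U × U => F.G n (proj j v) :=
    (F.measurable_G n).comp (measurable_proj j)
  rw [F.integral_Φbar_proj n _ (hb n) j hφ ha, integral_empirical x hm, integral_empirical x hG,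
    F.dev_centred hb j n hφ ha]
  simp only [centred, mul_sub]
  rw [empAvg_sub]
  have : empAvg (fun v => F.G n (proj j v) * ∫ y, φ y ∂(F.η j (n + 1))) x
      = (∫ y, φ y ∂(F.η j (n + 1))) * empAvg (fun v => F.G n (proj j v)) x := by
    rw [← empAvg_const_mul]; congr 1; funext v; ring
  rw [this, sub_div, mul_div_cancel_right₀ _ hpos.ne']

end Basic

/-! ### Mean square errors of a single marginal filter. -/

section Level

variable {U : Type u} [MeasurableSpace U] (F : Model U)

lemma inv_le_empAvg_G {c : ℝ} (hl : ∀ n x, c⁻¹ ≤ F.G n x) {N : ℕ} [NeZero N] (j : Fin 2) (n : ℕ)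
    (x : Fin N → U × U) : c⁻¹ ≤ empAvg (fun v => F.G n (proj j v)) x := by
  simpa [empAvg_const] using empAvg_mono (fun v => hl n (proj j v)) x

/-- The constant in the mean square error bound for one marginal particle filter. -/
noncomputable def levelConst (c : ℝ) : ℕ → ℝ
  | 0 => 1
  | n + 1 => 1 + 4 * c ^ 4 * levelConst c n

lemma levelConst_pos (c : ℝ) (n : ℕ) : 0 < levelConst c n := by
  induction n with
  | zero => simp [levelConst]
  | succ n ih => rw [levelConst]; positivity

/-- Sampling contributes a²/N. The bias contributes c² times the previous mean square error at
`centred`, which is bounded by 2ca; hence the factor 4c⁴ in `levelConst`. -/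
lemma integral_sq_dev_le {c : ℝ} (hc : 0 < c) (hb : ∀ n x, F.G n x ≤ c)
    (hl : ∀ n x, c⁻¹ ≤ F.G n x) (N : ℕ) [NeZero N] (j : Fin 2) (n : ℕ) {φ : U → ℝ} {a : ℝ}
    (hφ : Measurable φ) (ha : ∀ u, |φ u| ≤ a) :
    ∫ ω, F.dev j n φ (ω n) ^ 2 ∂(F.law N) ≤ levelConst c n * a ^ 2 / N := by
  have hsq : ∀ {ψ : U → ℝ} {b : ℝ}, (∀ u, |ψ u| ≤ b) → ∀ (P : Measure (U × U))
      [IsProbabilityMeasure P], ∫ v, ψ (proj j v) ^ 2 ∂P ≤ b ^ 2 := fun h P _ =>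
    (le_abs_self _).trans (abs_integral_le_of_abs_le fun _ => by
      rw [abs_sq]; exact sq_le_sq_of_abs_le (h _))
  -- The test function and its bound change at every step, so both must vary.
  induction n generalizing φ a with
  | zero =>
    have hψ : Measurable fun v : U × U => φ (proj j v) := hφ.comp (measurable_proj j)
    have hm := ((F.measurable_dev (N := N) j 0 hφ).pow_const 2)
    rw [F.integral_law_zero N hm]
    have h := integral_sq_empAvg_sub_le (N := N) F.η₀ hψ (fun _ => ha _) (∫ u, φ u ∂(F.η j 0))
    refine h.trans ?_
    rw [F.η_zero, integral_map (measurable_proj j).aemeasurable hφ.aestronglyMeasurable,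
      sub_self, levelConst]
    have := hsq ha F.η₀
    simp only [ne_eq, OfNat.ofNat_ne_zero, not_false_eq_true, zero_pow, add_zero, one_mul]
    gcongr
  | succ n ih =>
    have hψ : Measurable fun v : U × U => φ (proj j v) := hφ.comp (measurable_proj j)
    have hm := ((F.measurable_dev (N := N) j (n + 1) hφ).pow_const 2)
    have hbd : ∀ x : Fin N → U × U, |F.dev j (n + 1) φ x ^ 2| ≤ (2 * a) ^ 2 := fun x => by
      rw [abs_sq]; exact sq_le_sq_of_abs_le (F.abs_dev_le hb j (n + 1) ha _)
    have hch := F.measurable_centred j n hφ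
    have hca := F.abs_centred_le hb j n ha
    have hint := F.integrable_sq_dev hb N j n hch hca
    rw [F.integral_law_succ N n hm hbd]
    have hstep : ∀ x : Fin N → U × U,
        ∫ y, F.dev j (n + 1) φ y ^ 2 ∂(Measure.pi fun _ : Fin N => F.Φbar n (empirical x))
          ≤ a ^ 2 / N + c ^ 2 * F.dev j n (F.centred j n φ) x ^ 2 := fun x => by
      have h1 := F.inv_le_empAvg_G hl j n x
      have h0 : 0 < empAvg (fun v => F.G n (proj j v)) x := (inv_pos.mpr hc).trans_le h1
      refine (integral_sq_empAvg_sub_le (N := N) (F.Φbar n (empirical x)) hψ (fun _ => ha _)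
        (∫ u, φ u ∂(F.η j (n + 1)))).trans ?_
      rw [F.integral_Φbar_empirical_sub hb j n hφ ha x h0]
      have := hsq ha (F.Φbar n (empirical x))
      gcongr
      rw [div_eq_inv_mul, mul_pow]
      gcongr
      exact inv_le_of_inv_le₀ hc h1
    calc _ ≤ ∫ ω, (a ^ 2 / N + c ^ 2 * F.dev j n (F.centred j n φ) (ω n) ^ 2) ∂(F.law N) := by
          refine integral_mono ?_ ((integrable_const _).add (hint.const_mul _))
            fun ω => hstep (ω n)
          exact integrable_of_abs_le
            ((F.measurable_integral_pi_Φbar N n hm).comp (measurable_pi_apply n))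
            fun ω => abs_integral_le_of_abs_le hbd
      _ = a ^ 2 / N + c ^ 2 * ∫ ω, F.dev j n (F.centred j n φ) (ω n) ^ 2 ∂(F.law N) := by
          rw [integral_add (integrable_const _) (hint.const_mul _), integral_const_mul]; simp
      _ ≤ a ^ 2 / N + c ^ 2 * (levelConst c n * (2 * c * a) ^ 2 / N) := by
          gcongr
          exact ih hch hca
      _ = levelConst c (n + 1) * a ^ 2 / N := by rw [levelConst]; ring

/-! ### Normalising constants -/

lemma Z_le_pow {c : ℝ} (hb : ∀ n x, F.G n x ≤ c) (j : Fin 2) (n : ℕ) : F.Z j n ≤ c ^ n := by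
  induction n with
  | zero => simp [Z_zero]
  | succ n ih =>
    have := F.isProbabilityMeasure_η hb j n
    rw [F.Z_succ hb, pow_succ]
    exact mul_le_mul ih ((le_abs_self _).trans (abs_integral_le_of_abs_le (F.abs_G_le hb n)))
      (F.integral_G_pos hb _ n).le ((F.Z_pos hb j n).le.trans ih)

lemma empMean_eq_empAvg {N : ℕ} (j : Fin 2) (n : ℕ) (ω : ℕ → Fin N → U × U) :
    F.empMean j n ω = empAvg (fun v => F.G n (proj j v)) (ω n) := rfl

lemma abs_empMean_le {c : ℝ} (hb : ∀ n x, F.G n x ≤ c) {N : ℕ} [NeZero N] (j : Fin 2) (n : ℕ)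
    (ω : ℕ → Fin N → U × U) : |F.empMean j n ω| ≤ c :=
  abs_empAvg_le (fun _ => F.abs_G_le hb n _) (ω n)

lemma empMean_eq_add_dev {N : ℕ} (j : Fin 2) (n : ℕ) (ω : ℕ → Fin N → U × U) :
    F.empMean j n ω = ∫ u, F.G n u ∂(F.η j n) + F.dev j n (F.G n) (ω n) := by
  rw [empMean_eq_empAvg, dev]; ring

lemma ZN_succ {N : ℕ} (j : Fin 2) (n : ℕ) (ω : ℕ → Fin N → U × U) :
    F.ZN j (n + 1) ω = F.ZN j n ω * F.empMean j n ω := Finset.prod_range_succ _ _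

lemma measurable_ZN (N : ℕ) (j : Fin 2) (n : ℕ) :
    Measurable fun ω : ℕ → Fin N → U × U => F.ZN j n ω :=
  Finset.measurable_prod _ fun p _ =>
    (measurable_empAvg ((F.measurable_G p).comp (measurable_proj j))).comp (measurable_pi_apply p)

lemma abs_ZN_le {c : ℝ} (hb : ∀ n x, F.G n x ≤ c) {N : ℕ} [NeZero N] (j : Fin 2) (n : ℕ)
    (ω : ℕ → Fin N → U × U) : |F.ZN j n ω| ≤ c ^ n := by
  rw [ZN, Finset.abs_prod]
  exact (Finset.prod_le_prod (fun _ _ => abs_nonneg _)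
    fun p _ => F.abs_empMean_le hb j p ω).trans (by simp)

lemma integrable_sq_ZN_sub {c : ℝ} (hb : ∀ n x, F.G n x ≤ c) (N : ℕ) [NeZero N] (j : Fin 2)
    (n : ℕ) : Integrable (fun ω => (F.ZN j n ω - F.Z j n) ^ 2) (F.law N) :=
  integrable_of_abs_le (((F.measurable_ZN N j n).sub_const _).pow_const 2)
    (a := (2 * c ^ n) ^ 2) fun ω => by
      rw [abs_sq]
      refine sq_le_sq_of_abs_le (abs_sub_le_two_mul (F.abs_ZN_le hb j n ω) ?_)
      rw [abs_of_pos (F.Z_pos hb j n)]; exact F.Z_le_pow hb j n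

/-- The constant in the mean square error bound for one normalising constant. -/
noncomputable def normConst (c : ℝ) : ℕ → ℝ
  | 0 => 0
  | n + 1 => 2 * (c ^ 2 * normConst c n + (c ^ n) ^ 2 * (levelConst c n * c ^ 2))

lemma normConst_nonneg (c : ℝ) (n : ℕ) : 0 ≤ normConst c n := by
  induction n with
  | zero => simp [normConst]
  | succ n ih => have := levelConst_pos c n; rw [normConst]; positivity

/-- One factor of the product is replaced at a time: the old error is multiplied by a bounded
empirical mean, and the new error is Z times the filter error at G_n. -/
lemma integral_sq_ZN_sub_le {c : ℝ} (hc : 0 < c) (hb : ∀ n x, F.G n x ≤ c)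
    (hl : ∀ n x, c⁻¹ ≤ F.G n x) (N : ℕ) [NeZero N] (j : Fin 2) (n : ℕ) :
    ∫ ω, (F.ZN j n ω - F.Z j n) ^ 2 ∂(F.law N) ≤ normConst c n / N := by
  induction n with
  | zero => simp [ZN, Z_zero, normConst]
  | succ n ih =>
    have hi1 : Integrable (fun ω => c ^ 2 * (F.ZN j n ω - F.Z j n) ^ 2) (F.law N) :=
      (F.integrable_sq_ZN_sub hb N j n).const_mul _
    have hi2 : Integrable (fun ω => (c ^ n) ^ 2 * F.dev j n (F.G n) (ω n) ^ 2) (F.law N) :=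
      (F.integrable_sq_dev hb N j n (F.measurable_G n) (F.abs_G_le hb n)).const_mul _
    have hpt : ∀ ω : ℕ → Fin N → U × U, (F.ZN j (n + 1) ω - F.Z j (n + 1)) ^ 2
        ≤ 2 * (c ^ 2 * (F.ZN j n ω - F.Z j n) ^ 2 +
          (c ^ n) ^ 2 * F.dev j n (F.G n) (ω n) ^ 2) := fun ω => by
      have h : F.ZN j (n + 1) ω - F.Z j (n + 1) = F.empMean j n ω * (F.ZN j n ω - F.Z j n) +
          F.Z j n * F.dev j n (F.G n) (ω n) := by
        rw [F.ZN_succ, F.Z_succ hb, F.empMean_eq_add_dev]; ring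
      rw [h]
      refine (sq_add_le_two_mul _ _).trans ?_
      rw [mul_pow, mul_pow]
      have h1 := sq_le_sq_of_abs_le (F.abs_empMean_le hb j n ω)
      have h2 := F.Z_le_pow hb j n
      have h3 := F.Z_pos hb j n
      gcongr
    refine (integral_mono (F.integrable_sq_ZN_sub hb N j (n + 1)) ((hi1.add hi2).const_mul 2)
      hpt).trans ?_
    calc
      _ = 2 * (c ^ 2 * ∫ ω, (F.ZN j n ω - F.Z j n) ^ 2 ∂(F.law N) +
          (c ^ n) ^ 2 * ∫ ω, F.dev j n (F.G n) (ω n) ^ 2 ∂(F.law N)) := by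
        rw [integral_const_mul]
        simp only [Pi.add_apply]
        rw [integral_add hi1 hi2, integral_const_mul, integral_const_mul]
      _ ≤ 2 * (c ^ 2 * (normConst c n / N) + (c ^ n) ^ 2 * (levelConst c n * c ^ 2 / N)) := by
        gcongr
        exact F.integral_sq_dev_le hc hb hl N j n (F.measurable_G n) (F.abs_G_le hb n)
      _ = normConst c (n + 1) / N := by rw [normConst]; ring

end Level

end Model

lemma abs_min_dist_sq_le {U : Type u} [MetricSpace U] (v : U × U) :
    |(min (dist v.1 v.2) 1) ^ 2| ≤ 1 := by
  have h0 : 0 ≤ min (dist v.1 v.2) 1 := le_min dist_nonneg zero_le_one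
  rw [abs_sq]
  exact pow_le_one₀ h0 (min_le_right _ _)

namespace Model

/-! ### Level discrepancies and the coupled sampling error. -/

section Coupled

variable {U : Type u} [MetricSpace U] [MeasurableSpace U] (F : Model U)

/-- The quantity whose square is `B_N(n)`. -/
noncomputable def rootB (N : ℕ) [NeZero N] (n : ℕ) : ℝ :=
  ∑ p ∈ Finset.range (n + 1),
      (√(∫ ω, (min (dist (ω p 0).1 (ω p 0).2) 1) ^ 2 ∂(F.law N)) + tv (F.η 0 p) (F.η 1 p)) +
    ∑ p ∈ Finset.Icc 1 n, kernelDist (F.Mj 0 p) (F.Mj 1 p)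

lemma B_eq_rootB_sq (N : ℕ) [NeZero N] (n : ℕ) : F.B N n = F.rootB N n ^ 2 := rfl

lemma rootB_zero (N : ℕ) [NeZero N] :
    F.rootB N 0 = √(∫ ω, (min (dist (ω 0 0).1 (ω 0 0).2) 1) ^ 2 ∂(F.law N)) +
      tv (F.η 0 0) (F.η 1 0) := by
  simp [rootB]

lemma rootB_succ (N : ℕ) [NeZero N] (n : ℕ) :
    F.rootB N (n + 1) = F.rootB N n +
      (√(∫ ω, (min (dist (ω (n + 1) 0).1 (ω (n + 1) 0).2) 1) ^ 2 ∂(F.law N)) +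
        tv (F.η 0 (n + 1)) (F.η 1 (n + 1)) + kernelDist (F.Mj 0 (n + 1)) (F.Mj 1 (n + 1))) := by
  rw [rootB, rootB, Finset.sum_range_succ, Finset.sum_Icc_succ_top (by omega)]
  ring

lemma rootB_nonneg (N : ℕ) [NeZero N] (n : ℕ) : 0 ≤ F.rootB N n :=
  add_nonneg (Finset.sum_nonneg fun _ _ => add_nonneg (Real.sqrt_nonneg _) (tv_nonneg _ _))
    (Finset.sum_nonneg fun _ _ => kernelDist_nonneg _ _)

lemma tv_add_kernelDist_le_rootB_succ (N : ℕ) [NeZero N] (n : ℕ) :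
    tv (F.η 0 (n + 1)) (F.η 1 (n + 1)) + kernelDist (F.Mj 0 (n + 1)) (F.Mj 1 (n + 1))
      ≤ F.rootB N (n + 1) := by
  have := F.rootB_nonneg N n
  have := Real.sqrt_nonneg
    (∫ ω, (min (dist (ω (n + 1) 0).1 (ω (n + 1) 0).2) 1) ^ 2 ∂(F.law N))
  rw [rootB_succ]
  linarith

lemma rootB_le_succ (N : ℕ) [NeZero N] (n : ℕ) : F.rootB N n ≤ F.rootB N (n + 1) := by
  have := Real.sqrt_nonneg
    (∫ ω, (min (dist (ω (n + 1) 0).1 (ω (n + 1) 0).2) 1) ^ 2 ∂(F.law N))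
  have := tv_nonneg (F.η 0 (n + 1)) (F.η 1 (n + 1))
  have := kernelDist_nonneg (F.Mj 0 (n + 1)) (F.Mj 1 (n + 1))
  rw [rootB_succ]
  linarith

lemma tv_le_rootB (N : ℕ) [NeZero N] (n : ℕ) : tv (F.η 0 n) (F.η 1 n) ≤ F.rootB N n := by
  cases n with
  | zero => rw [rootB_zero]; exact le_add_of_nonneg_left (Real.sqrt_nonneg _)
  | succ n =>
    have := F.tv_add_kernelDist_le_rootB_succ N n
    have := kernelDist_nonneg (F.Mj 0 (n + 1)) (F.Mj 1 (n + 1))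
    linarith

lemma integral_min_dist_sq_le_B (N : ℕ) [NeZero N] (n : ℕ) :
    ∫ ω, (min (dist (ω n 0).1 (ω n 0).2) 1) ^ 2 ∂(F.law N) ≤ F.B N n := by
  have h : √(∫ ω, (min (dist (ω n 0).1 (ω n 0).2) 1) ^ 2 ∂(F.law N)) ≤ F.rootB N n := by
    cases n with
    | zero => rw [rootB_zero]; exact le_add_of_nonneg_right (tv_nonneg _ _)
    | succ n =>
      have := F.rootB_nonneg N n
      have := tv_nonneg (F.η 0 (n + 1)) (F.η 1 (n + 1))
      have := kernelDist_nonneg (F.Mj 0 (n + 1)) (F.Mj 1 (n + 1))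
      rw [rootB_succ]
      linarith
  exact (Real.sqrt_le_left (F.rootB_nonneg N n)).mp h

variable {F} {c C : ℝ} {Λ : ℕ → ℝ}

lemma A1.le (hA : F.A1 c C) (n : ℕ) (x : U) : F.G n x ≤ c := (hA.bounded n x).2.le

lemma A1.inv_le (hA : F.A1 c C) (n : ℕ) (x : U) : c⁻¹ ≤ F.G n x := (hA.bounded n x).1.le

/-- Product rule: (A1) controls the increment of G and (A2) that of M(φ). The result is linear in a,
so iteration changes only the constant. -/
lemma abs_centred_sub_le (hc : 0 < c) (hA : F.A1 c C) (hC : 0 < C) (hA2 : F.A2 Λ)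
    (hΛ : ∀ n, 0 < Λ n) (j : Fin 2)
    (n : ℕ) {φ : U → ℝ} {a : ℝ} (ha0 : 0 ≤ a) (ha : ∀ u, |φ u| ≤ a)
    (hL : ∀ u u', |φ u - φ u'| ≤ a * dist u u') (u u' : U) :
    |F.centred j n φ u - F.centred j n φ u'| ≤ (2 * C + c * Λ (n + 1)) * a * dist u u' := by
  have := F.isProbabilityMeasure_η hA.le j (n + 1)
  have h1 := hA.lipschitz n u u'
  have h2 := abs_sub_le_two_mul (abs_integral_le_of_abs_le (μ := F.Mj j (n + 1) u) ha)
    (abs_integral_le_of_abs_le (μ := F.η j (n + 1)) ha)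
  have h3 := hA2.abs_sub_le hΛ (by omega : 1 ≤ n + 1) j ha0 ha hL u u'
  have h4 := F.abs_G_le hA.le n u'
  have e : F.centred j n φ u - F.centred j n φ u'
      = (F.G n u - F.G n u') * (∫ y, φ y ∂(F.Mj j (n + 1) u) - ∫ y, φ y ∂(F.η j (n + 1))) +
        F.G n u' * (∫ y, φ y ∂(F.Mj j (n + 1) u) - ∫ y, φ y ∂(F.Mj j (n + 1) u')) := by
    simp only [centred]; ring
  rw [e]
  refine (abs_add_le _ _).trans ?_
  rw [abs_mul, abs_mul]
  calc _ ≤ C * dist u u' * (2 * a) + c * (Λ (n + 1) * a * dist u u') := by gcongr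
    _ = _ := by ring

/-- The two functions differ through the kernels and through the centring constants; both
discrepancies at time n + 1 are summands of `rootB`. -/
lemma abs_centred_zero_sub_centred_one_le (hA : F.A1 c C) (N : ℕ) [NeZero N]
    (n : ℕ) {φ : U → ℝ} {a L : ℝ} (ha0 : 0 < a) (hφ : Measurable φ) (ha : ∀ u, |φ u| ≤ a)
    (hL : ∀ u u', |φ u - φ u'| ≤ L * dist u u') (u : U) :
    |F.centred 0 n φ u - F.centred 1 n φ u| ≤ 2 * c * a * F.rootB N (n + 1) := by
  have := F.isProbabilityMeasure_η hA.le 0 (n + 1)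
  have := F.isProbabilityMeasure_η hA.le 1 (n + 1)
  have h1 := abs_integral_sub_le_kernelDist (F.Mj 0 (n + 1)) (F.Mj 1 (n + 1)) ha0 ha hL u
  have h2 := abs_integral_sub_le_tv (F.η 0 (n + 1)) (F.η 1 (n + 1)) hφ ha
  have h3 := F.tv_add_kernelDist_le_rootB_succ N n
  have h4 := kernelDist_nonneg (F.Mj 0 (n + 1)) (F.Mj 1 (n + 1))
  have h5 := F.abs_G_le hA.le n u
  have e : F.centred 0 n φ u - F.centred 1 n φ u
      = F.G n u * ((∫ y, φ y ∂(F.Mj 0 (n + 1) u) - ∫ y, φ y ∂(F.Mj 1 (n + 1) u)) -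
        (∫ y, φ y ∂(F.η 0 (n + 1)) - ∫ y, φ y ∂(F.η 1 (n + 1)))) := by
    simp only [centred]; ring
  rw [e, abs_mul]
  calc _ ≤ c * (2 * a * F.rootB N (n + 1)) := by
        refine mul_le_mul h5 ((abs_sub _ _).trans ((add_le_add h1 h2).trans ?_)) (abs_nonneg _)
          ((abs_nonneg _).trans h5)
        nlinarith
    _ = _ := by ring

/-- The constant in the mean square error bound for the difference of the two marginal particle
filters. -/
noncomputable def diffConst (c C : ℝ) (Λ : ℕ → ℝ) : ℕ → ℝ
  | 0 => 4
  | n + 1 => 4 + 4 * (c ^ 2 * (diffConst c C Λ n * (2 * c + 2 * C + c * Λ (n + 1)) ^ 2) +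
      c ^ 2 * (levelConst c n * (2 * c) ^ 2) + 4 * c ^ 6 * (diffConst c C Λ n * (c + C) ^ 2) +
      4 * c ^ 6 * (levelConst c n * (2 * c) ^ 2))

lemma diffConst_pos (c C : ℝ) (Λ : ℕ → ℝ) (n : ℕ) : 0 < diffConst c C Λ n := by
  induction n with
  | zero => simp [diffConst]
  | succ n ih => have := levelConst_pos c n; rw [diffConst]; positivity

variable [BorelSpace U]

lemma measurable_of_abs_sub_le {φ : U → ℝ} {L : ℝ} (hL : ∀ u u', |φ u - φ u'| ≤ L * dist u u') :
    Measurable φ :=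
  (LipschitzWith.of_dist_le' (K := L) fun y z => hL y z).continuous.measurable

variable [SecondCountableTopology U]

lemma measurable_min_dist_sq : Measurable fun v : U × U => (min (dist v.1 v.2) 1) ^ 2 := by
  fun_prop

/-- The increment of φ is at most a times the distance and also at most 2a, hence at most 2a times
the truncated distance. -/
lemma integral_sq_sub_le (P : Measure (U × U)) [IsProbabilityMeasure P] {φ : U → ℝ} {a : ℝ}
    (ha0 : 0 ≤ a) (ha : ∀ u, |φ u| ≤ a) (hL : ∀ u u', |φ u - φ u'| ≤ a * dist u u') :
    ∫ v, (φ (proj 0 v) - φ (proj 1 v)) ^ 2 ∂P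
      ≤ 4 * a ^ 2 * ∫ v, (min (dist v.1 v.2) 1) ^ 2 ∂P := by
  have hφ := measurable_of_abs_sub_le hL
  rw [← integral_const_mul]
  refine integral_mono
    (integrable_of_abs_le (((hφ.comp (measurable_proj 0)).sub
      (hφ.comp (measurable_proj 1))).pow_const 2) (a := (2 * a) ^ 2) fun v => ?_)
    ((integrable_of_abs_le measurable_min_dist_sq abs_min_dist_sq_le).const_mul _) fun v => ?_
  · rw [abs_sq]; exact sq_le_sq_of_abs_le (abs_sub_le_two_mul (ha _) (ha _))
  · have h : |φ (proj 0 v) - φ (proj 1 v)| ≤ 2 * a * min (dist v.1 v.2) 1 := by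
      rw [mul_min_of_nonneg _ _ (by positivity), mul_one]
      refine le_min ((hL _ _).trans ?_) (abs_sub_le_two_mul (ha _) (ha _))
      change a * dist v.1 v.2 ≤ _
      have : 0 ≤ a * dist v.1 v.2 := by positivity
      linarith
    calc _ ≤ (2 * a * min (dist v.1 v.2) 1) ^ 2 := sq_le_sq_of_abs_le h
      _ = _ := by ring

/-- `diffDev` is the error of one empirical average, that of φ(u_1) - φ(u_2). Its variance is small
when the pair is close, which separate bounds for the two filters would miss. -/
lemma integral_sq_diffDev_pi_le (F : Model U) (N : ℕ) [NeZero N] (n : ℕ)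
    (P : Measure (U × U)) [IsProbabilityMeasure P] {φ : U → ℝ} {a : ℝ} (ha0 : 0 ≤ a)
    (ha : ∀ u, |φ u| ≤ a) (hL : ∀ u u', |φ u - φ u'| ≤ a * dist u u') :
    ∫ y, F.diffDev n φ y ^ 2 ∂(Measure.pi fun _ : Fin N => P)
      ≤ 4 * a ^ 2 * (∫ v, (min (dist v.1 v.2) 1) ^ 2 ∂P) / N +
        ((∫ v, φ (proj 0 v) ∂P - ∫ u, φ u ∂(F.η 0 n)) -
          (∫ v, φ (proj 1 v) ∂P - ∫ u, φ u ∂(F.η 1 n))) ^ 2 := by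
  have hφ := measurable_of_abs_sub_le hL
  have hφj : ∀ j, Measurable fun v : U × U => φ (proj j v) := fun j =>
    hφ.comp (measurable_proj j)
  have hi : ∀ j, Integrable (fun v : U × U => φ (proj j v)) P := fun j =>
    integrable_of_abs_le (hφj j) fun v => ha _
  have h := integral_sq_empAvg_sub_le (N := N) P ((hφj 0).sub (hφj 1))
    (fun v => abs_sub_le_two_mul (ha _) (ha _)) (∫ u, φ u ∂(F.η 0 n) - ∫ u, φ u ∂(F.η 1 n))
  have e1 : ∀ y : Fin N → U × U, F.diffDev n φ y
      = empAvg (fun v => φ (proj 0 v) - φ (proj 1 v)) y -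
        (∫ u, φ u ∂(F.η 0 n) - ∫ u, φ u ∂(F.η 1 n)) := fun y => by
    rw [empAvg_sub, diffDev, dev, dev]; ring
  simp only [e1]
  refine h.trans (add_le_add ?_ (le_of_eq ?_))
  · have := integral_sq_sub_le P ha0 ha hL
    gcongr
    exact this
  · simp only [Pi.sub_apply]
    rw [integral_sub (hi 0) (hi 1)]
    ring

end Coupled

end Model

lemma integral_sq_le_of_sq_le {Ω : Type*} [MeasurableSpace Ω] {P : Measure Ω}
    {f g₁ g₂ g₃ g₄ : Ω → ℝ} {α₁ α₂ α₃ α₄ b₁ b₂ b₃ b₄ : ℝ}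
    (h₁ : Integrable g₁ P) (h₂ : Integrable g₂ P) (h₃ : Integrable g₃ P) (h₄ : Integrable g₄ P)
    (hα₁ : 0 ≤ α₁) (hα₂ : 0 ≤ α₂) (hα₃ : 0 ≤ α₃) (hα₄ : 0 ≤ α₄)
    (hb₁ : ∫ ω, g₁ ω ∂P ≤ b₁) (hb₂ : ∫ ω, g₂ ω ∂P ≤ b₂) (hb₃ : ∫ ω, g₃ ω ∂P ≤ b₃)
    (hb₄ : ∫ ω, g₄ ω ∂P ≤ b₄) (hf0 : ∀ ω, 0 ≤ f ω)
    (hf : ∀ ω, f ω ≤ 4 * (α₁ * g₁ ω + α₂ * g₂ ω + α₃ * g₃ ω + α₄ * g₄ ω)) :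
    ∫ ω, f ω ∂P ≤ 4 * (α₁ * b₁ + α₂ * b₂ + α₃ * b₃ + α₄ * b₄) := by
  have i₁ := h₁.const_mul α₁
  have i₂ := h₂.const_mul α₂
  have i₃ := h₃.const_mul α₃
  have i₄ := h₄.const_mul α₄
  have i₁₂ : Integrable (fun ω => α₁ * g₁ ω + α₂ * g₂ ω) P := i₁.add i₂
  have i₁₂₃ : Integrable (fun ω => α₁ * g₁ ω + α₂ * g₂ ω + α₃ * g₃ ω) P := i₁₂.add i₃
  refine (integral_mono_of_nonneg (Filter.Eventually.of_forall hf0) ((i₁₂₃.add i₄).const_mul 4)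
    (Filter.Eventually.of_forall hf)).trans ?_
  rw [integral_const_mul]
  simp only [Pi.add_apply]
  rw [integral_add i₁₂₃ i₄, integral_add i₁₂ i₃, integral_add i₁ i₂, integral_const_mul,
    integral_const_mul, integral_const_mul, integral_const_mul]
  gcongr

namespace Model

lemma diffDev_G_add {U : Type u} [MeasurableSpace U] {F : Model U} {N : ℕ} (n : ℕ)
    (x : Fin N → U × U) :
    empAvg (fun v => F.G n (proj 0 v)) x - empAvg (fun v => F.G n (proj 1 v)) x
      = F.diffDev n (F.G n) x + (∫ u, F.G n u ∂(F.η 0 n) - ∫ u, F.G n u ∂(F.η 1 n)) := by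
  rw [diffDev, dev, dev]; ring

variable {U : Type u} [MetricSpace U] [MeasurableSpace U] {F : Model U} {c C : ℝ} {Λ : ℕ → ℝ}

/-! ### The difference of the normalising constants -/

/-- The constants `K(n)` of the bound for the difference of the normalising constants. -/
noncomputable def finalConst (c C : ℝ) (Λ : ℕ → ℝ) : ℕ → ℝ
  | 0 => 1
  | n + 1 => 4 * (c ^ 2 + levelConst c n * c ^ 2 + (c ^ n) ^ 2 * (diffConst c C Λ n * (c + C) ^ 2) +
      4 * c ^ 2 * normConst c n)

lemma finalConst_pos (hc : 0 < c) (C : ℝ) (Λ : ℕ → ℝ) (n : ℕ) : 0 < finalConst c C Λ n := by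
  cases n with
  | zero => simp [finalConst]
  | succ n =>
    have := levelConst_pos c n
    have := diffConst_pos c C Λ n
    have := normConst_nonneg c n
    rw [finalConst]
    positivity

lemma B_nonneg (F : Model U) (N : ℕ) [NeZero N] (n : ℕ) : 0 ≤ F.B N n := by
  rw [B_eq_rootB_sq]; positivity

lemma Bbar_nonneg (F : Model U) (N : ℕ) [NeZero N] {K : ℕ → ℝ} (hK : ∀ n, 0 < K n) (n : ℕ) :
    0 ≤ F.Bbar N K n := by
  induction n with
  | zero => exact mul_nonneg (hK 0).le (F.B_nonneg N 0)
  | succ n ih =>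
    have := F.B_nonneg N n
    exact mul_nonneg (hK _).le (by positivity)

lemma integrable_sq_ZN_sub_ZN_sub (hA : F.A1 c C) (N : ℕ) [NeZero N] (n : ℕ) :
    Integrable (fun ω => ((F.ZN 0 n ω - F.ZN 1 n ω) - (F.Z 0 n - F.Z 1 n)) ^ 2) (F.law N) := by
  refine integrable_of_abs_le
    ((((F.measurable_ZN N 0 n).sub (F.measurable_ZN N 1 n)).sub_const _).pow_const 2)
    (a := (2 * (2 * c ^ n)) ^ 2) fun ω => ?_
  have hZ : ∀ j, |F.Z j n| ≤ c ^ n := fun j => by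
    rw [abs_of_pos (F.Z_pos hA.le j n)]; exact F.Z_le_pow hA.le j n
  rw [abs_sq]
  exact sq_le_sq_of_abs_le (abs_sub_le_two_mul
    (abs_sub_le_two_mul (F.abs_ZN_le hA.le 0 n ω) (F.abs_ZN_le hA.le 1 n ω))
    (abs_sub_le_two_mul (hZ 0) (hZ 1)))

/-- The splitting attaches each random error either to a bounded factor or to a deterministic
discrepancy of the levels, so no product of two random errors needs higher moments. -/
lemma sq_ZN_succ_sub_le (hA : F.A1 c C) {N : ℕ} [NeZero N] (n : ℕ) (ω : ℕ → Fin N → U × U) :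
    ((F.ZN 0 (n + 1) ω - F.ZN 1 (n + 1) ω) - (F.Z 0 (n + 1) - F.Z 1 (n + 1))) ^ 2
      ≤ 4 * (c ^ 2 * ((F.ZN 0 n ω - F.ZN 1 n ω) - (F.Z 0 n - F.Z 1 n)) ^ 2 +
        (F.Z 0 n - F.Z 1 n) ^ 2 * F.dev 0 n (F.G n) (ω n) ^ 2 +
        (c ^ n) ^ 2 * F.diffDev n (F.G n) (ω n) ^ 2 +
        (2 * c * tv (F.η 0 n) (F.η 1 n)) ^ 2 * (F.ZN 1 n ω - F.Z 1 n) ^ 2) := by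
  have hη0 := F.isProbabilityMeasure_η hA.le 0 n
  have hη1 := F.isProbabilityMeasure_η hA.le 1 n
  have e : (F.ZN 0 (n + 1) ω - F.ZN 1 (n + 1) ω) - (F.Z 0 (n + 1) - F.Z 1 (n + 1))
      = F.empMean 0 n ω * ((F.ZN 0 n ω - F.ZN 1 n ω) - (F.Z 0 n - F.Z 1 n)) +
        (F.Z 0 n - F.Z 1 n) * F.dev 0 n (F.G n) (ω n) +
        F.ZN 1 n ω * F.diffDev n (F.G n) (ω n) +
        (∫ u, F.G n u ∂(F.η 0 n) - ∫ u, F.G n u ∂(F.η 1 n)) * (F.ZN 1 n ω - F.Z 1 n) := by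
    rw [F.ZN_succ, F.ZN_succ, F.Z_succ hA.le, F.Z_succ hA.le, diffDev, F.empMean_eq_add_dev,
      F.empMean_eq_add_dev]
    ring
  rw [e]
  refine (sq_add_le_four_mul _ _ _ _).trans ?_
  simp only [mul_pow _ _ 2]
  have h1 := sq_le_sq_of_abs_le (F.abs_empMean_le hA.le 0 n ω)
  have h2 := sq_le_sq_of_abs_le (F.abs_ZN_le hA.le 1 n ω)
  have h3 := sq_le_sq_of_abs_le
    (abs_integral_sub_le_tv (F.η 0 n) (F.η 1 n) (F.measurable_G n) (F.abs_G_le hA.le n))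
  simp only [mul_pow _ _ 2] at h3
  gcongr

/-! ### The coupled mean square error bound -/

/-- Both biases are ratios with denominators at least c⁻¹. Their difference separates into a change
of numerator (evaluation point, then function) and a change of denominator (random part, then
deterministic part). -/
lemma sq_bias_le (hc : 0 < c) (hA : F.A1 c C) {N : ℕ} [NeZero N] (n : ℕ) {φ : U → ℝ} {a : ℝ}
    (hφ : Measurable φ) (ha : ∀ u, |φ u| ≤ a) (x : Fin N → U × U) :
    ((∫ v, φ (proj 0 v) ∂(F.Φbar n (empirical x)) - ∫ u, φ u ∂(F.η 0 (n + 1))) -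
        (∫ v, φ (proj 1 v) ∂(F.Φbar n (empirical x)) - ∫ u, φ u ∂(F.η 1 (n + 1)))) ^ 2
      ≤ 4 * (c ^ 2 * F.diffDev n (F.centred 0 n φ) x ^ 2 +
        c ^ 2 * F.dev 1 n (fun u => F.centred 0 n φ u - F.centred 1 n φ u) x ^ 2 +
        4 * c ^ 6 * a ^ 2 * F.diffDev n (F.G n) x ^ 2 +
        4 * c ^ 6 * tv (F.η 0 n) (F.η 1 n) ^ 2 * F.dev 1 n (F.centred 1 n φ) x ^ 2) := by
  have hη0 := F.isProbabilityMeasure_η hA.le 0 n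
  have hη1 := F.isProbabilityMeasure_η hA.le 1 n
  have hb0 := F.inv_le_empAvg_G hA.inv_le 0 n x
  have hb1 := F.inv_le_empAvg_G hA.inv_le 1 n x
  have hci := inv_pos.mpr hc
  have hp0 := hci.trans_le hb0
  have hp1 := hci.trans_le hb1
  have hd1 := F.dev_centred hA.le 1 n hφ ha x
  have habs : |F.dev 1 n (F.centred 1 n φ) x| ≤ 2 * c * a := by
    rw [hd1]; exact abs_empAvg_le (fun _ => F.abs_centred_le hA.le 1 n ha _) x
  have hsplit : F.dev 0 n (F.centred 0 n φ) x - F.dev 1 n (F.centred 1 n φ) x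
      = F.diffDev n (F.centred 0 n φ) x +
        F.dev 1 n (fun u => F.centred 0 n φ u - F.centred 1 n φ u) x := by
    have hi : ∀ j, Integrable (F.centred j n φ) (F.η 1 n) := fun j =>
      integrable_of_abs_le (F.measurable_centred j n hφ) (F.abs_centred_le hA.le j n ha)
    simp only [diffDev, dev]
    rw [integral_sub (hi 0) (hi 1), empAvg_sub]
    ring
  have htv := abs_integral_sub_le_tv (F.η 0 n) (F.η 1 n) (F.measurable_G n) (F.abs_G_le hA.le n)
  rw [F.integral_Φbar_empirical_sub hA.le 0 n hφ ha x hp0,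
    F.integral_Φbar_empirical_sub hA.le 1 n hφ ha x hp1]
  have hdiff := diffDev_G_add (F := F) n x
  set b0 := empAvg (fun v => F.G n (proj 0 v)) x
  set b1 := empAvg (fun v => F.G n (proj 1 v)) x
  set d := F.dev 1 n (F.centred 1 n φ) x
  set D := F.diffDev n (F.centred 0 n φ) x
  set e := F.dev 1 n (fun u => F.centred 0 n φ u - F.centred 1 n φ u) x
  set g := F.diffDev n (F.G n) x
  set t := ∫ u, F.G n u ∂(F.η 0 n) - ∫ u, F.G n u ∂(F.η 1 n)
  have hi0 : b0⁻¹ ≤ c := inv_le_of_inv_le₀ hc hb0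
  have hi1 : b1⁻¹ ≤ c := inv_le_of_inv_le₀ hc hb1
  have hq0 : 0 < b0⁻¹ := inv_pos.mpr hp0
  have hq1 : 0 < b1⁻¹ := inv_pos.mpr hp1
  -- Here b0⁻¹ - b1⁻¹ = -(b0 - b1) b0⁻¹ b1⁻¹, with b0 - b1 = g + t.
  have hR : F.dev 0 n (F.centred 0 n φ) x / b0 - d / b1
      = b0⁻¹ * D + b0⁻¹ * e + -(b0⁻¹ * b1⁻¹ * d * g) + -(b0⁻¹ * b1⁻¹ * t * d) := by
    have h0 : F.dev 0 n (F.centred 0 n φ) x = D + e + d := by linarith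
    have h1 : b0 = b1 + g + t := by linarith
    rw [h0]
    field_simp
    rw [h1]
    ring
  rw [hR]
  refine (sq_add_le_four_mul _ _ _ _).trans ?_
  have s1 : (b0⁻¹ * D) ^ 2 ≤ c ^ 2 * D ^ 2 := by rw [mul_pow]; gcongr
  have s2 : (b0⁻¹ * e) ^ 2 ≤ c ^ 2 * e ^ 2 := by rw [mul_pow]; gcongr
  have hd2 : d ^ 2 ≤ (2 * c * a) ^ 2 := sq_le_sq_of_abs_le habs
  have ht2 : t ^ 2 ≤ (2 * c * tv (F.η 0 n) (F.η 1 n)) ^ 2 := sq_le_sq_of_abs_le htv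
  -- Of the product d g, only d is bounded uniformly and g keeps its mean square. In the product t d
  -- below, t is bounded by total variation and d stays random, supplying the 1/N.
  have s3 : (-(b0⁻¹ * b1⁻¹ * d * g)) ^ 2 ≤ 4 * c ^ 6 * a ^ 2 * g ^ 2 :=
    calc _ = (b0⁻¹) ^ 2 * (b1⁻¹) ^ 2 * d ^ 2 * g ^ 2 := by ring
      _ ≤ c ^ 2 * c ^ 2 * (2 * c * a) ^ 2 * g ^ 2 := by gcongr
      _ = _ := by ring
  have s4 : (-(b0⁻¹ * b1⁻¹ * t * d)) ^ 2 ≤ 4 * c ^ 6 * tv (F.η 0 n) (F.η 1 n) ^ 2 * d ^ 2 :=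
    calc _ = (b0⁻¹) ^ 2 * (b1⁻¹) ^ 2 * t ^ 2 * d ^ 2 := by ring
      _ ≤ c ^ 2 * c ^ 2 * (2 * c * tv (F.η 0 n) (F.η 1 n)) ^ 2 * d ^ 2 := by gcongr
      _ = _ := by ring
  linarith

variable [BorelSpace U]

/-- The induction step for the bias alone. The 4 subtracted from the constant is reserved for the
sampling variance. -/
lemma integral_sq_bias_le (hc : 0 < c) (hC : 0 < C) (hΛ : ∀ n, 0 < Λ n) (hA : F.A1 c C)
    (hA2 : F.A2 Λ) (N : ℕ) [NeZero N] (n : ℕ)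
    (ih : ∀ {ψ : U → ℝ} {b : ℝ}, 0 < b → (∀ u, |ψ u| ≤ b) →
      (∀ u u', |ψ u - ψ u'| ≤ b * dist u u') →
      ∫ ω, F.diffDev n ψ (ω n) ^ 2 ∂(F.law N) ≤ diffConst c C Λ n * b ^ 2 * F.B N n / N)
    {φ : U → ℝ} {a : ℝ} (ha0 : 0 < a) (ha : ∀ u, |φ u| ≤ a)
    (hL : ∀ u u', |φ u - φ u'| ≤ a * dist u u') :
    ∫ ω, ((∫ v, φ (proj 0 v) ∂(F.Φbar n (empirical (ω n))) - ∫ u, φ u ∂(F.η 0 (n + 1))) -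
        (∫ v, φ (proj 1 v) ∂(F.Φbar n (empirical (ω n))) - ∫ u, φ u ∂(F.η 1 (n + 1)))) ^ 2
          ∂(F.law N)
      ≤ (diffConst c C Λ (n + 1) - 4) * a ^ 2 * F.B N (n + 1) / N := by
  have hφ := measurable_of_abs_sub_le hL
  have hm := fun j => F.measurable_centred j n hφ
  have hca := fun j => F.abs_centred_le hA.le j n ha
  have hroot := F.rootB_nonneg N n
  have hroot' := F.rootB_le_succ N n
  have htv0 := tv_nonneg (F.η 0 n) (F.η 1 n)
  have htv := (F.tv_le_rootB N n).trans hroot'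
  have hd := diffConst_pos c C Λ n
  have hl := levelConst_pos c n
  have hB : F.B N n ≤ F.B N (n + 1) := by
    rw [B_eq_rootB_sq, B_eq_rootB_sq]; gcongr
  have hsub := abs_centred_zero_sub_centred_one_le hA N n ha0 hφ ha hL
  have hΛn := hΛ (n + 1)
  have h1 : ∫ ω, F.diffDev n (F.centred 0 n φ) (ω n) ^ 2 ∂(F.law N)
      ≤ diffConst c C Λ n * ((2 * c + 2 * C + c * Λ (n + 1)) * a) ^ 2 * F.B N (n + 1) / N := by
    -- One number b must bound both the supremum norm (2ca) and the Lipschitz constant of `centred`,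
    -- so the two bounds are added. The choice c + C for G_n below has the same origin.
    refine (ih (b := (2 * c + 2 * C + c * Λ (n + 1)) * a) (by positivity)
      (fun u => (hca 0 u).trans ?_) fun u u' =>
        (abs_centred_sub_le hc hA hC hA2 hΛ 0 n ha0.le ha hL u u').trans ?_).trans ?_
    · gcongr; nlinarith [mul_pos hc hΛn]
    · gcongr; linarith
    · gcongr
  have h2 := F.integral_sq_dev_le hc hA.le hA.inv_le N 1 n ((hm 0).sub (hm 1)) hsub
  have h3 : ∫ ω, F.diffDev n (F.G n) (ω n) ^ 2 ∂(F.law N)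
      ≤ diffConst c C Λ n * (c + C) ^ 2 * F.B N (n + 1) / N := by
    refine (ih (b := c + C) (by positivity) (fun u => (F.abs_G_le hA.le n u).trans ?_)
      fun u u' => (hA.lipschitz n u u').trans ?_).trans ?_
    · linarith
    · gcongr; linarith
    · gcongr
  have h4 := F.integral_sq_dev_le hc hA.le hA.inv_le N 1 n (hm 1) (hca 1)
  refine (integral_sq_le_of_sq_le
    (F.integrable_sq_diffDev hA.le N n (hm 0) (hca 0))
    (F.integrable_sq_dev hA.le N 1 n ((hm 0).sub (hm 1)) hsub)
    (F.integrable_sq_diffDev hA.le N n (F.measurable_G n) (F.abs_G_le hA.le n))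
    (F.integrable_sq_dev hA.le N 1 n (hm 1) (hca 1))
    (by positivity) (by positivity) (by positivity) (by positivity)
    h1 h2 h3 h4 (fun _ => sq_nonneg _)
    fun ω => sq_bias_le hc hA n hφ ha (ω n)).trans ?_
  have ht2 : tv (F.η 0 n) (F.η 1 n) ^ 2 ≤ F.B N (n + 1) := by
    rw [B_eq_rootB_sq]; gcongr
  calc _ ≤ 4 * (c ^ 2 * (diffConst c C Λ n * ((2 * c + 2 * C + c * Λ (n + 1)) * a) ^ 2 *
          F.B N (n + 1) / N) +
        c ^ 2 * (levelConst c n * (2 * c * a * F.rootB N (n + 1)) ^ 2 / N) +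
        4 * c ^ 6 * a ^ 2 * (diffConst c C Λ n * (c + C) ^ 2 * F.B N (n + 1) / N) +
        4 * c ^ 6 * F.B N (n + 1) * (levelConst c n * (2 * c * a) ^ 2 / N)) := by gcongr
    _ = _ := by rw [diffConst, B_eq_rootB_sq]; ring

variable [SecondCountableTopology U]

/-- Given the past, the mean square splits into the variance of the pair, measured by the truncated
distance, and the bias of `integral_sq_bias_le`. -/
lemma integral_sq_diffDev_le (hc : 0 < c) (hC : 0 < C) (hΛ : ∀ n, 0 < Λ n) (hA : F.A1 c C)
    (hA2 : F.A2 Λ) (N : ℕ) [NeZero N] (n : ℕ) {φ : U → ℝ} {a : ℝ} (ha0 : 0 < a)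
    (ha : ∀ u, |φ u| ≤ a) (hL : ∀ u u', |φ u - φ u'| ≤ a * dist u u') :
    ∫ ω, F.diffDev n φ (ω n) ^ 2 ∂(F.law N) ≤ diffConst c C Λ n * a ^ 2 * F.B N n / N := by
  have hg : Measurable fun y : Fin N → U × U => (min (dist (y 0).1 (y 0).2) 1) ^ 2 :=
    measurable_min_dist_sq.comp (measurable_pi_apply 0)
  have hpi : ∀ (P : Measure (U × U)) [IsProbabilityMeasure P],
      ∫ y : Fin N → U × U, (min (dist (y 0).1 (y 0).2) 1) ^ 2 ∂(Measure.pi fun _ => P)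
        = ∫ v, (min (dist v.1 v.2) 1) ^ 2 ∂P := fun P _ =>
    integral_comp_eval (μ := fun _ : Fin N => P) (i := 0)
      measurable_min_dist_sq.aestronglyMeasurable
  induction n generalizing φ a with
  | zero =>
    have hφ := measurable_of_abs_sub_le hL
    rw [F.integral_law_zero N ((F.measurable_diffDev 0 hφ).pow_const 2)]
    refine (integral_sq_diffDev_pi_le F N 0 F.η₀ ha0.le ha hL).trans ?_
    have h := F.integral_min_dist_sq_le_B N 0
    rw [F.integral_law_zero N hg, hpi] at h
    have he : ∀ j, ∫ v, φ (proj j v) ∂F.η₀ = ∫ u, φ u ∂(F.η j 0) := fun j => by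
      rw [F.η_zero, integral_map (measurable_proj j).aemeasurable hφ.aestronglyMeasurable]
    rw [he, he, sub_self, sub_self, sub_zero, zero_pow two_ne_zero, add_zero, diffConst]
    gcongr
  | succ n ih =>
    have hφ := measurable_of_abs_sub_le hL
    have hm : Measurable fun y : Fin N → U × U => F.diffDev (n + 1) φ y ^ 2 :=
      (F.measurable_diffDev (n + 1) hφ).pow_const 2
    have hbd : ∀ y : Fin N → U × U, |F.diffDev (n + 1) φ y ^ 2| ≤ (2 * (2 * a)) ^ 2 := fun y => by
      rw [abs_sq]; exact sq_le_sq_of_abs_le (F.abs_diffDev_le hA.le (n + 1) ha _)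
    have hbias := integral_sq_bias_le hc hC hΛ hA hA2 N n ih ha0 ha hL
    -- Given the past, the first particle has law `Φbar` at the empirical measure. This identifies
    -- the averaged variance bound with the particle distance term in B_N(n+1).
    have hmin := F.integral_min_dist_sq_le_B N (n + 1)
    rw [F.integral_law_succ N n hg fun y => abs_min_dist_sq_le (y 0)] at hmin
    simp only [hpi] at hmin
    have hη0 := F.isProbabilityMeasure_η hA.le 0 (n + 1)
    have hη1 := F.isProbabilityMeasure_η hA.le 1 (n + 1)
    have hmΦ : ∀ j, Measurable fun ω : ℕ → Fin N → U × U =>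
        ∫ v, φ (proj j v) ∂(F.Φbar n (empirical (ω n))) := fun j =>
      ((hφ.comp (measurable_proj j)).stronglyMeasurable.integral_kernel
        (κ := ⟨fun x : Fin N → U × U => F.Φbar n (empirical x),
          measurable_Φbar_empirical F n⟩)).measurable.comp (measurable_pi_apply n)
    have i1 : Integrable (fun ω : ℕ → Fin N → U × U => 4 * a ^ 2 *
        (∫ v, (min (dist v.1 v.2) 1) ^ 2 ∂(F.Φbar n (empirical (ω n)))) / N) (F.law N) := by
      simp only [← hpi]
      exact ((integrable_of_abs_le
        ((F.measurable_integral_pi_Φbar N n hg).comp (measurable_pi_apply n))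
        fun ω => abs_integral_le_of_abs_le fun y => abs_min_dist_sq_le (y 0)).const_mul _).div_const
          _
    have i2 : Integrable (fun ω : ℕ → Fin N → U × U =>
        ((∫ v, φ (proj 0 v) ∂(F.Φbar n (empirical (ω n))) - ∫ u, φ u ∂(F.η 0 (n + 1))) -
        (∫ v, φ (proj 1 v) ∂(F.Φbar n (empirical (ω n))) - ∫ u, φ u ∂(F.η 1 (n + 1)))) ^ 2)
        (F.law N) := by
      refine integrable_of_abs_le ((((hmΦ 0).sub_const _).sub ((hmΦ 1).sub_const _)).pow_const 2)
        (a := (2 * (2 * a)) ^ 2) fun ω => ?_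
      rw [abs_sq]
      refine sq_le_sq_of_abs_le (abs_sub_le_two_mul ?_ ?_) <;>
      exact abs_sub_le_two_mul (abs_integral_le_of_abs_le fun v => ha _)
        (abs_integral_le_of_abs_le ha)
    rw [F.integral_law_succ N n hm hbd]
    refine (integral_mono (integrable_of_abs_le
      ((F.measurable_integral_pi_Φbar N n hm).comp (measurable_pi_apply n))
      fun ω => abs_integral_le_of_abs_le hbd) (i1.add i2) fun ω =>
        integral_sq_diffDev_pi_le F N (n + 1) (F.Φbar n (empirical (ω n))) ha0.le ha hL).trans ?_
    simp only [Pi.add_apply]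
    rw [integral_add i1 i2, integral_div, integral_const_mul]
    calc _ ≤ 4 * a ^ 2 * F.B N (n + 1) / N +
          (diffConst c C Λ (n + 1) - 4) * a ^ 2 * F.B N (n + 1) / N := by gcongr
      _ = _ := by ring

lemma integral_sq_ZN_sub_ZN_sub_le (hc : 0 < c) (hC : 0 < C) (hΛ : ∀ n, 0 < Λ n)
    (hA : F.A1 c C) (hA2 : F.A2 Λ) (N : ℕ) [NeZero N] (n : ℕ) :
    ∫ ω, ((F.ZN 0 n ω - F.ZN 1 n ω) - (F.Z 0 n - F.Z 1 n)) ^ 2 ∂(F.law N)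
      ≤ F.Bbar N (finalConst c C Λ) n / N := by
  induction n with
  | zero =>
    have := F.Bbar_nonneg N (finalConst_pos hc C Λ) 0
    simp only [ZN, Z_zero, Finset.range_zero, Finset.prod_empty, sub_self, ne_eq,
      OfNat.ofNat_ne_zero, not_false_eq_true, zero_pow, integral_zero]
    positivity
  | succ n ih =>
    have hD := integral_sq_diffDev_le hc hC hΛ hA hA2 N n (φ := F.G n) (a := c + C)
      (by positivity) (fun u => (F.abs_G_le hA.le n u).trans (by linarith))
      fun u u' => (hA.lipschitz n u u').trans
        (mul_le_mul_of_nonneg_right (by linarith) dist_nonneg)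
    refine (integral_sq_le_of_sq_le (integrable_sq_ZN_sub_ZN_sub hA N n)
      (F.integrable_sq_dev hA.le N 0 n (F.measurable_G n) (F.abs_G_le hA.le n))
      (F.integrable_sq_diffDev hA.le N n (F.measurable_G n) (F.abs_G_le hA.le n))
      (F.integrable_sq_ZN_sub hA.le N 1 n)
      (sq_nonneg _) (sq_nonneg _) (sq_nonneg _) (sq_nonneg _) ih
      (F.integral_sq_dev_le hc hA.le hA.inv_le N 0 n (F.measurable_G n) (F.abs_G_le hA.le n))
      hD (F.integral_sq_ZN_sub_le hc hA.le hA.inv_le N 1 n) (fun _ => sq_nonneg _)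
      (sq_ZN_succ_sub_le hA n)).trans ?_
    have h1 := F.B_nonneg N n
    have h2 := F.Bbar_nonneg N (finalConst_pos hc C Λ) n
    have hl := levelConst_pos c n
    have hd := diffConst_pos c C Λ n
    have hn := normConst_nonneg c n
    rw [Bbar, finalConst]
    set b := F.Bbar N (finalConst c C Λ) n
    set t := tv (F.η 0 n) (F.η 1 n)
    set z := F.Z 0 n - F.Z 1 n
    set k₁ := c ^ 2
    set k₂ := levelConst c n * c ^ 2
    set k₃ := (c ^ n) ^ 2 * (diffConst c C Λ n * (c + C) ^ 2)
    set k₄ := 4 * c ^ 2 * normConst c n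
    have hk₁ : 0 ≤ k₁ := by positivity
    have hk₂ : 0 ≤ k₂ := by positivity
    have hk₃ : 0 ≤ k₃ := by positivity
    have hk₄ : 0 ≤ k₄ := by positivity
    -- The recursion for `Bbar` has a single constant, so each coefficient is enlarged to the sum of
    -- all four.
    calc _ = 4 * (k₁ * b + k₂ * z ^ 2 + k₃ * F.B N n + k₄ * t ^ 2) / N := by ring
      _ ≤ 4 * ((k₁ + k₂ + k₃ + k₄) * b + (k₁ + k₂ + k₃ + k₄) * z ^ 2 +
          (k₁ + k₂ + k₃ + k₄) * F.B N n + (k₁ + k₂ + k₃ + k₄) * t ^ 2) / N := by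
        gcongr <;> linarith
      _ = _ := by ring

end Model

end CoupledPF

theorem mainTheorem2 (c C : ℝ) (hc : 1 < c) (hC : 0 < C) (Λ : ℕ → ℝ) (hΛ : ∀ n, 0 < Λ n) :
    ∃ K : ℕ → ℝ, (∀ n, 0 < K n) ∧
      ∀ (U : Type*) [MetricSpace U] [SecondCountableTopology U] [MeasurableSpace U] [BorelSpace U]
        (F : CoupledPF.Model U), F.A1 c C → F.A2 Λ →
        ∀ n : ℕ, 1 ≤ n → ∀ (N : ℕ) [NeZero N],
          Integrable (fun ω => ((F.ZN 0 n ω - F.ZN 1 n ω) - (F.Z 0 n - F.Z 1 n)) ^ 2) (F.law N) ∧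
          ∫ ω, ((F.ZN 0 n ω - F.ZN 1 n ω) - (F.Z 0 n - F.Z 1 n)) ^ 2 ∂(F.law N)
            ≤ F.Bbar N K n / N := by
  have hc0 : 0 < c := zero_lt_one.trans hc
  exact ⟨CoupledPF.Model.finalConst c C Λ, CoupledPF.Model.finalConst_pos hc0 C Λ,
    fun U _ _ _ _ F hA hA2 n _ N _ => ⟨CoupledPF.Model.integrable_sq_ZN_sub_ZN_sub hA N n,
      CoupledPF.Model.integral_sq_ZN_sub_ZN_sub_le hc0 hC hΛ hA hA2 N n⟩⟩
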